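/- Let $\mathcal G$ be an étale, Hausdorff topological groupoid whose unit space $\mathcal G^{(0)}$ is a Cantor space (a Cantor groupoid), with source and range maps $s,r$. Assume that $\mathcal G$ is - effective: whenever $x\in\mathcal G^{(0)}$, $\gamma\neq x$, $s(\gamma)=r(\gamma)=x$, and $B$ is a compact open bisection containing $\gamma$, there is $\gamma'\in B$ with $s(\gamma')\neq r(\gamma')$; - minimal: the orbit $\{r(\gamma): s(\gamma)=x\}$ is dense in $\mathcal G^{(0)}$ for every $x\in\mathcal G^{(0)}$; - purely infinite: for every compact open $K\subseteq\mathcal G^{(0)}$ there are compact open bisections $B,B'\subseteq\mathcal G$ with $s(B)=s(B')=K$ such that $r(B)$ and $r(B')$ are disjoint and contained in $K$. Let $\mathsf F(\mathcal G)\leq \mathrm{Homeo}(\mathcal G^{(0)})$ be the topological full group, i.e. the group of the homeomorphisms $s(\gamma)\mapsto r(\gamma)$ ($\gamma\in B$) given by the compact open bisections $B$ with $s(B)=r(B)=\mathcal G^{(0)}$. Let $\mathsf A(\mathcal G)$ be the alternating group, i.e. the subgroup of $\mathsf F(\mathcal G)$ generated by all $g\in\mathsf F(\mathcal G)$ of order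 three for which there are pairwise disjoint compact open sets $X_0,X_1,X_2\subseteq\mathcal G^{(0)}$ with $g(X_j)=X_{j+1}$ (indices modulo $3$) and $g(x)=x$ for all $x\notin X_0\cup X_1\cup X_2$. A character of a group $\Gamma$ is a function $\chi\colon\Gamma\to\mathbb C$ with $\chi(1)=1$ and $\chi(gh)=\chi(hg)$ for all $g,h\in\Gamma$ such that for all $g_1,\dots,g_n\in\Gamma$ the matrix $(\chi(g_ig_j^{-1}))_{i,j}$ is positive semidefinite. It is indecomposable if it is not of the form $\lambda\chi_1+(1-\lambda)\chi_2$ with $\lambda\in(0,1)$ and characters $\chi_1\neq\chi_2$. Then $\mathsf A(\mathcal G)$ has no proper characters: its indecomposable characters are exactly the trivial character ($\chi(g)=1$ for all $g$) and the regular character ($\chi(1)=1$ and $\chi(g)=0$ for $g\neq1$). -/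

import Mathlib

universe u v

open CategoryTheory Topology
open scoped ComplexOrder

/-! ## Topological groupoids

A groupoid is a small category `X` in which every morphism is invertible. Its objects are the
units, the underlying set of the groupoid is the set `Arrow X` of all its morphisms; the source
and the range of `γ : Arrow X` are `γ.left` and `γ.right`. -/

namespace TopGroupoid

section Algebra

variable {X : Type u} [Groupoid.{v} X]

/-- The unit at the object `x`. -/
def unit (x : X) : Arrow X := Arrow.mk (𝟙 x)

/-- The inverse of an element of the groupoid. -/
def inv (γ : Arrow X) : Arrow X := Arrow.mk (Groupoid.inv γ.hom : γ.right ⟶ γ.left)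

/-- The product `γ η`, defined when the source of `γ` is the range of `η` (first `η`, then `γ`). -/
def mul (γ η : Arrow X) (h : η.right = γ.left) : Arrow X :=
  Arrow.mk ((η.hom : η.left ⟶ η.right) ≫ eqToHom h ≫ (γ.hom : γ.left ⟶ γ.right))

end Algebra

/-- A topological groupoid: multiplication (on composable pairs) and inversion are continuous, and
the topology of the unit space is the one induced by the inclusion of the units. -/
class TopologicalGroupoid (X : Type u) [TopologicalSpace X] [Groupoid.{v} X]
    [TopologicalSpace (Arrow X)] : Prop where
  isEmbedding_unit : IsEmbedding (unit : X → Arrow X)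
  continuous_inv : Continuous (inv : Arrow X → Arrow X)
  continuous_mul : Continuous
    fun p : {p : Arrow X × Arrow X // p.2.right = p.1.left} => mul p.1.1 p.1.2 p.2

/-- An étale groupoid: the source and range maps are local homeomorphisms. -/
class EtaleGroupoid (X : Type u) [TopologicalSpace X] [Groupoid.{v} X]
    [TopologicalSpace (Arrow X)] : Prop extends TopologicalGroupoid X where
  isLocalHomeomorph_source : IsLocalHomeomorph (fun γ : Arrow X => (γ.left : X))
  isLocalHomeomorph_range : IsLocalHomeomorph (fun γ : Arrow X => (γ.right : X))

/-- A Cantor space: a space homeomorphic to `{0, 1}^ℕ`. -/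
class CantorSpace (X : Type u) [TopologicalSpace X] : Prop where
  nonempty_homeomorph : Nonempty (X ≃ₜ (ℕ → Bool))

instance (X : Type u) [TopologicalSpace X] [CantorSpace X] : CompactSpace X :=
  (CantorSpace.nonempty_homeomorph (X := X)).elim fun e => e.symm.compactSpace

section Notions

variable {X : Type u} [TopologicalSpace X] [Groupoid.{v} X] [TopologicalSpace (Arrow X)]

/-- An open bisection: an open set of arrows on which the source and range maps restrict to
homeomorphisms onto open subsets of the unit space. -/
structure IsOpenBisection (B : Set (Arrow X)) : Prop where
  isOpen : IsOpen B
  source : IsOpenEmbedding (B.domRestrict fun γ => (γ.left : X))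
  range : IsOpenEmbedding (B.domRestrict fun γ => (γ.right : X))

/-- A compact open bisection. -/
structure IsCompactOpenBisection (B : Set (Arrow X)) : Prop extends IsOpenBisection B where
  isCompact : IsCompact B

/-- The set `s(B)` of sources of the elements of `B`. -/
def sourceSet (B : Set (Arrow X)) : Set X := (fun γ => (γ.left : X)) '' B

/-- The set `r(B)` of ranges of the elements of `B`. -/
def rangeSet (B : Set (Arrow X)) : Set X := (fun γ => (γ.right : X)) '' B

/-- The orbit of a unit `x`: the ranges of all arrows with source `x`. -/
def orbit (x : X) : Set X := {y | ∃ γ : Arrow X, γ.left = x ∧ γ.right = y}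

variable (X)

/-- Minimality: every orbit is dense in the unit space. -/
def IsMinimal : Prop := ∀ x : X, Dense (orbit x)

/-- Effectiveness: a compact open bisection containing a nontrivial isotropy element also contains
an arrow with distinct source and range. -/
def IsEffective : Prop :=
  ∀ (x : X) (γ : Arrow X), γ.left = x → γ.right = x → γ ≠ unit x →
    ∀ B : Set (Arrow X), IsCompactOpenBisection B → γ ∈ B → ∃ γ' ∈ B, γ'.left ≠ γ'.right

/-- Pure infiniteness: for every compact open set `K` of units there are compact open bisections
with source `K` and with disjoint ranges contained in `K`. -/
def IsPurelyInfinite : Prop :=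
  ∀ K : Set X, IsCompact K → IsOpen K → ∃ B B' : Set (Arrow X),
    IsCompactOpenBisection B ∧ IsCompactOpenBisection B' ∧
    sourceSet B = K ∧ sourceSet B' = K ∧
    Disjoint (rangeSet B) (rangeSet B') ∧ rangeSet B ⊆ K ∧ rangeSet B' ⊆ K

end Notions

/-! ## The topological full group and the alternating group -/

section FullGroup

variable {X : Type u} [TopologicalSpace X] [Groupoid.{v} X] [TopologicalSpace (Arrow X)]

/-- `φ` is the homeomorphism of the unit space given by a compact open bisection with full source
and range: it maps the source of each arrow of the bisection to the range of that arrow. -/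
def IsGivenByFullBisection (φ : X ≃ₜ X) : Prop :=
  ∃ B : Set (Arrow X), IsCompactOpenBisection B ∧ sourceSet B = Set.univ ∧
    rangeSet B = Set.univ ∧ ∀ γ ∈ B, φ γ.left = γ.right

theorem isGivenByFullBisection_iff_section [EtaleGroupoid X] [CompactSpace X] (φ : X ≃ₜ X) :
    IsGivenByFullBisection φ ↔ ∃ ρ : X → Arrow X, Continuous ρ ∧
      (∀ x, (ρ x).left = x) ∧ ∀ x, (ρ x).right = φ x := by
  constructor
  · rintro ⟨B, hB, hs, -, hφ⟩
    have hsurj : Function.Surjective (B.domRestrict fun γ => (γ.left : X)) := by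
      intro x
      obtain ⟨γ, hγ, rfl⟩ : x ∈ sourceSet B := hs ▸ Set.mem_univ x
      exact ⟨⟨γ, hγ⟩, rfl⟩
    let e := hB.source.toIsEmbedding.toHomeomorphOfSurjective hsurj
    have he : ∀ x, ((e.symm x : Arrow X).left : X) = x := fun x => e.apply_symm_apply x
    refine ⟨fun x => (e.symm x : Arrow X), continuous_subtype_val.comp e.symm.continuous,
      he, fun x => ?_⟩
    have h := hφ _ (e.symm x).2
    rw [he] at h
    exact h.symm
  · rintro ⟨ρ, hρ, hl, hr⟩
    have hs : IsLocalHomeomorph (fun γ : Arrow X => (γ.left : X)) :=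
      EtaleGroupoid.isLocalHomeomorph_source
    have ht : IsLocalHomeomorph (fun γ : Arrow X => (γ.right : X)) :=
      EtaleGroupoid.isLocalHomeomorph_range
    have hopen : IsOpenEmbedding ρ := by
      refine hs.isOpenEmbedding_of_comp ?_ hρ
      have : (fun γ : Arrow X => (γ.left : X)) ∘ ρ = id := funext hl
      rw [this]
      exact IsOpenEmbedding.id
    have hB : IsOpen (Set.range ρ) := hopen.isOpen_range
    refine ⟨Set.range ρ, ⟨⟨hB, ?_, ?_⟩, isCompact_range hρ⟩, ?_, ?_, ?_⟩
    · refine (hs.comp hB.isOpenEmbedding_subtypeVal.isLocalHomeomorph).isOpenEmbedding_of_injective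
        ?_
      rintro ⟨_, x, rfl⟩ ⟨_, y, rfl⟩ h
      have h' : x = y := by simpa [hl] using h
      exact Subtype.ext (congrArg ρ h')
    · refine (ht.comp hB.isOpenEmbedding_subtypeVal.isLocalHomeomorph).isOpenEmbedding_of_injective
        ?_
      rintro ⟨_, x, rfl⟩ ⟨_, y, rfl⟩ h
      have h' : x = y := by simpa [hr] using h
      exact Subtype.ext (congrArg ρ h')
    · exact Set.eq_univ_of_forall fun x => ⟨ρ x, ⟨x, rfl⟩, hl x⟩
    · exact Set.eq_univ_of_forall fun x =>
        ⟨ρ (φ.symm x), ⟨_, rfl⟩, (hr _).trans (φ.apply_symm_apply x)⟩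
    · rintro _ ⟨x, rfl⟩
      rw [hl, hr]

variable (X)

/-- The topological full group of an étale groupoid with compact unit space: the group of the
homeomorphisms of the unit space given by compact open bisections with full source and range. -/
def fullGroup [EtaleGroupoid X] [CompactSpace X] : Subgroup (X ≃ₜ X) where
  carrier := {φ | IsGivenByFullBisection φ}
  one_mem' := (isGivenByFullBisection_iff_section _).2
    ⟨unit, TopologicalGroupoid.isEmbedding_unit.continuous, fun _ => rfl, fun _ => rfl⟩
  mul_mem' := by
    rintro φ ψ hφ hψ
    obtain ⟨ρ, hρ, hl, hr⟩ := (isGivenByFullBisection_iff_section _).1 hφ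
    obtain ⟨σ, hσ, kl, kr⟩ := (isGivenByFullBisection_iff_section _).1 hψ
    have h : ∀ x, (σ x).right = (ρ (ψ x)).left := fun x => (kr x).trans (hl _).symm
    refine (isGivenByFullBisection_iff_section _).2
      ⟨fun x => mul (ρ (ψ x)) (σ x) (h x), ?_, kl, fun x => hr _⟩
    exact TopologicalGroupoid.continuous_mul.comp
      (f := fun x => (⟨(ρ (ψ x), σ x), h x⟩ :
        {p : Arrow X × Arrow X // p.2.right = p.1.left}))
      (((hρ.comp ψ.continuous).prodMk hσ).subtype_mk _)
  inv_mem' := by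
    rintro φ hφ
    obtain ⟨ρ, hρ, hl, hr⟩ := (isGivenByFullBisection_iff_section _).1 hφ
    refine (isGivenByFullBisection_iff_section _).2 ⟨fun x => inv (ρ (φ.symm x)),
      TopologicalGroupoid.continuous_inv.comp (hρ.comp φ.symm.continuous),
      fun x => (hr _).trans (φ.apply_symm_apply x), fun x => hl _⟩

/-- The alternating group: the subgroup generated by the elements `g` of order three of the
topological full group that permute cyclically three disjoint compact open sets and are the
identity elsewhere. -/
def alternatingGroup [EtaleGroupoid X] [CompactSpace X] : Subgroup (X ≃ₜ X) :=
  Subgroup.closure {g | g ∈ fullGroup X ∧ orderOf g = 3 ∧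
    ∃ Y : Fin 3 → Set X, (∀ j, IsCompact (Y j) ∧ IsOpen (Y j)) ∧
      Pairwise (fun i j => Disjoint (Y i) (Y j)) ∧
      (∀ j, g '' Y j = Y (j + 1)) ∧ ∀ x, x ∉ ⋃ j, Y j → g x = x}

theorem alternatingGroup_le_fullGroup [EtaleGroupoid X] [CompactSpace X] :
    alternatingGroup X ≤ fullGroup X :=
  (Subgroup.closure_le _).2 fun _ hg => hg.1

end FullGroup

end TopGroupoid

/-! ## Characters of discrete groups -/

namespace GroupCharacter

variable {Γ : Type u} [Group Γ]

/-- A character of a group: a normalised, conjugation invariant function of positive type. -/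
structure IsCharacter (χ : Γ → ℂ) : Prop where
  map_mul_comm : ∀ g h, χ (g * h) = χ (h * g)
  map_one : χ 1 = 1
  posSemidef : ∀ (n : ℕ) (g : Fin n → Γ),
    (Matrix.of fun i j => χ (g i * (g j)⁻¹)).PosSemidef

/-- `χ` is a nontrivial convex combination of two distinct characters. -/
def IsDecomposable (χ : Γ → ℂ) : Prop :=
  ∃ χ₁ χ₂ : Γ → ℂ, IsCharacter χ₁ ∧ IsCharacter χ₂ ∧ χ₁ ≠ χ₂ ∧
    ∃ t : ℝ, 0 < t ∧ t < 1 ∧ ∀ g, χ g = (t : ℂ) * χ₁ g + (1 - (t : ℂ)) * χ₂ g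

/-- An indecomposable character. -/
def IsIndecomposableCharacter (χ : Γ → ℂ) : Prop := IsCharacter χ ∧ ¬ IsDecomposable χ

variable (Γ)

/-- The identity (trivial) character. -/
def identityCharacter : Γ → ℂ := fun _ => 1

open Classical in
/-- The regular character. -/
noncomputable def regularCharacter : Γ → ℂ := fun g => if g = 1 then 1 else 0

/-- The indecomposable characters are exactly the identity character and the regular character. -/
def HasNoProperCharacters : Prop :=
  ∀ χ : Γ → ℂ, IsIndecomposableCharacter χ ↔ χ = identityCharacter Γ ∨ χ = regularCharacter Γ

end GroupCharacter

/-! Fix a three-cycle `h` supported in `V`, and call a product of conjugates of `h` living on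
pairwise disjoint translates of `V` a block. Blocks with equally many factors, each inside a proper
subset, are conjugate, so a character `χ` sees only the number of factors (`IsShiftable.char_eq`).
On blocks of even length its values are real, nonnegative and decreasing, by Cauchy–Schwarz, hence
tend to some `c` (`IsShiftable.exists_antitone`).

In the GNS space of `χ`, take weak limits of the vectors of longer and longer blocks in disjoint
regions. All inner products between such limits equal `c`, which forces them to be one vector `e`,
wherever the blocks live (`IsShiftable.exists_limit`). Since `e` can be approximated by blocks far
away from a given short block, it is insensitive to that block; as conjugates of `h` generate, `e`
pairs with every `v g` to the same number `c`. Finally let `g ≠ 1` displace a clopen set `D`, and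
let `b k` be blocks in `D`. The vectors of `b k * g⁻¹ * (b k)⁻¹` also converge weakly to `e`, while
their product with `v 1` is always `χ g`; so `χ g = c` (`IsShiftable.character_const`). Every
character is thus on the segment from the regular to the identity character, and the endpoints are
extreme.

The dynamical input is that every clopen set embeds by local arrows into every nonempty clopen set
(`exists_isEmb_into`), and that embeddings between proper clopen sets extend to the alternating
group (`exists_extension`). Together with a simplicity argument (`alternatingGroup_le_of_normal`)
these provide all properties in `IsShiftable`. -/

namespace GroupCharacter

open Filter
open scoped InnerProductSpace

/-! ### The GNS construction for characters -/

section Hilbert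

variable {Γ : Type u} [Group Γ] {χ : Γ → ℂ}

theorem IsCharacter.map_conj (hχ : IsCharacter χ) (a g : Γ) : χ (a * g * a⁻¹) = χ g := by
  rw [hχ.map_mul_comm, inv_mul_cancel_left]

theorem IsCharacter.map_inv (hχ : IsCharacter χ) (g : Γ) : χ g⁻¹ = star (χ g) := by
  have h := (hχ.posSemidef 2 ![1, g]).isHermitian.apply 0 1
  simpa using h.symm

theorem IsCharacter.sum_nonneg (hχ : IsCharacter χ) (f : Γ →₀ ℂ) :
    0 ≤ ∑ x ∈ f.support, ∑ y ∈ f.support, star (f x) * χ (x⁻¹ * y) * f y := by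
  let e := f.support.equivFin
  -- The inverses turn the kernel `g * h⁻¹` of the definition into the kernel `g⁻¹ * h` of the GNS
  -- vectors.
  have h := (hχ.posSemidef _ fun i => ((e.symm i : Γ))⁻¹).dotProduct_mulVec_nonneg
    (fun i => f (e.symm i))
  refine h.trans_eq ?_
  rw [← Finset.sum_coe_sort f.support, ← e.symm.sum_comp]
  refine Finset.sum_congr rfl fun i _ => ?_
  rw [← Finset.sum_coe_sort f.support, ← e.symm.sum_comp, Matrix.mulVec, dotProduct,
    Finset.mul_sum]
  refine Finset.sum_congr rfl fun j _ => ?_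
  simp [mul_assoc]

/-- The Gelfand-Naimark-Segal construction. -/
theorem IsCharacter.exists_vectors (hχ : IsCharacter χ) :
    ∃ (H : Type u) (_ : NormedAddCommGroup H) (_ : InnerProductSpace ℂ H) (_ : CompleteSpace H)
      (v : Γ → H), ∀ g h, ⟪v g, v h⟫_ℂ = χ (g⁻¹ * h) := by
  -- The Hilbert space is the reproducing kernel space of this operator-valued kernel on `ℂ`, and `v
  -- g` is the kernel function at `g` applied to `1`.
  let K : Matrix Γ Γ (ℂ →L[ℂ] ℂ) := Matrix.of fun g h => χ (g⁻¹ * h) • (1 : ℂ →L[ℂ] ℂ)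
  have hstar : ∀ g h : Γ, star (χ (g⁻¹ * h)) = χ (h⁻¹ * g) := fun g h => by
    rw [← hχ.map_inv, mul_inv_rev, inv_inv]
  have hK : K.PosSemidef := by
    have htfae := (RKHS.posSemidef_tfae (K := K)).out 0 2
    refine htfae.2 ⟨?_, fun f => ?_⟩
    · ext g h
      simp only [K, Matrix.conjTranspose_apply, Matrix.of_apply, star_smul, hstar, star_one]
    · have h := (Complex.le_def.1 (hχ.sum_nonneg f)).1
      refine h.trans_eq (congrArg Complex.re ?_)
      rw [Finsupp.sum]
      refine Finset.sum_congr rfl fun x _ => ?_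
      rw [Finsupp.sum]
      refine Finset.sum_congr rfl fun y _ => ?_
      simp only [K, Matrix.of_apply, smul_apply, one_apply_eq_self,
        smul_eq_mul, RCLike.inner_apply, map_mul]
      have := hstar y x
      simp only [RCLike.star_def] at this ⊢
      rw [this]
      ring
  have : Fact K.PosSemidef := ⟨hK⟩
  refine ⟨RKHS.OfKernel K, inferInstance, inferInstance, inferInstance,
    fun g => RKHS.kerFun (RKHS.OfKernel K) g (1 : ℂ), fun g h => ?_⟩
  rw [← RKHS.kernel_inner, RKHS.OfKernel.kernel_ofKernel]
  have := hstar h g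
  simp only [RCLike.star_def] at this
  simp [K, this]

end Hilbert

/-! ### Weak limits along an ultrafilter -/

section WeakLimit

variable {H : Type*} [NormedAddCommGroup H] [InnerProductSpace ℂ H]

/-- Weak convergence along a fixed nonprincipal ultrafilter on `ℕ`. -/
def IsWeakLimit (v : ℕ → H) (e : H) : Prop :=
  ∀ x, Tendsto (fun k => ⟪v k, x⟫_ℂ) (hyperfilter ℕ : Filter ℕ) (𝓝 ⟪e, x⟫_ℂ)

/-- Banach–Alaoglu, carried over to `H` by the Riesz isomorphism. -/
theorem exists_isWeakLimit [CompleteSpace H] (v : ℕ → H) (hv : ∀ k, ‖v k‖ ≤ 1) :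
    ∃ e, IsWeakLimit v e := by
  let φ : ℕ → WeakDual ℂ H := fun k => StrongDual.toWeakDual (InnerProductSpace.toDual ℂ H (v k))
  have hc := WeakDual.isCompact_closedBall (𝕜 := ℂ) (E := H) 0 1
  obtain ⟨ψ, -, hψ⟩ := isCompact_iff_ultrafilter_le_nhds.1 hc ((hyperfilter ℕ).map φ) (by
    rw [le_principal_iff]
    refine Filter.univ_mem' (f := (hyperfilter ℕ : Filter ℕ)) fun k => ?_
    simpa [φ] using hv k)
  refine ⟨(InnerProductSpace.toDual ℂ H).symm (WeakDual.toStrongDual ψ), fun x => ?_⟩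
  have h := ((WeakDual.eval_continuous x).tendsto ψ).comp hψ
  rw [InnerProductSpace.toDual_symm_apply]
  exact h

theorem IsWeakLimit.tendsto_right {v : ℕ → H} {e : H} (h : IsWeakLimit v e) (x : H) :
    Tendsto (fun k => ⟪x, v k⟫_ℂ) (hyperfilter ℕ : Filter ℕ) (𝓝 ⟪x, e⟫_ℂ) := by
  have := (Complex.continuous_conj.tendsto _).comp (h x)
  simpa [Function.comp_def, inner_conj_symm] using this

/-- Take the limit in `l` first, then in `k`. The ultrafilter is nonprincipal, so the diagonal,
where two blocks would share a region, never matters. -/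
theorem IsWeakLimit.inner_eq {v w : ℕ → H} {e f : H} (he : IsWeakLimit v e) (hf : IsWeakLimit w f)
    {m : ℕ → ℕ → ℂ} {c : ℂ} (hm : ∀ k l, k ≠ l → ⟪v k, w l⟫_ℂ = m k l)
    (hc : ∀ k, Tendsto (m k) atTop (𝓝 c)) : ⟪e, f⟫_ℂ = c := by
  have hle : (hyperfilter ℕ : Filter ℕ) ≤ atTop := by
    rw [← Nat.cofinite_eq_atTop]; exact hyperfilter_le_cofinite
  have h : ∀ k, ⟪v k, f⟫_ℂ = c := fun k =>
    tendsto_nhds_unique (hf.tendsto_right (v k)) (((hc k).congr' (by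
      filter_upwards [eventually_gt_atTop k] with l hl using (hm k l hl.ne).symm)).mono_left hle)
  exact tendsto_nhds_unique (he f) (tendsto_const_nhds.congr fun k => (h k).symm)

/-- The hypotheses make `‖e - f‖²` vanish; this is how all weak limits below get identified. -/
theorem eq_of_inner_eq {e f : H} {c : ℝ} (h1 : ⟪e, e⟫_ℂ = c) (h2 : ⟪f, f⟫_ℂ = c)
    (h3 : ⟪e, f⟫_ℂ = c) : e = f := by
  have h4 : ⟪f, e⟫_ℂ = c := by rw [← inner_conj_symm, h3, Complex.conj_ofReal]
  rw [← sub_eq_zero, ← inner_self_eq_zero (𝕜 := ℂ)]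
  simp only [inner_sub_left, inner_sub_right, h1, h2, h3, h4, sub_self]

end WeakLimit

end GroupCharacter

namespace GroupCharacter

open Filter
open scoped InnerProductSpace Pointwise

/-! ### Blocks and the values of a character on them -/

section Blocks

variable {Γ : Type u} [Group Γ] {X : Type v} [MulAction Γ X]

/-- `b` is a product of `n` conjugates of `h` by elements which move `V` to pairwise disjoint
subsets of `D`. -/
def IsBlock (h : Γ) (V D : Set X) (n : ℕ) (b : Γ) : Prop :=
  ∃ L : List Γ, L.Pairwise (fun a c => Disjoint (a • V) (c • V)) ∧ (∀ a ∈ L, a • V ⊆ D) ∧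
    L.length = n ∧ (L.map fun a => a * h * a⁻¹).prod = b

variable {h : Γ} {V D D' : Set X} {n n' : ℕ} {b b' : Γ}

theorem isBlock_single {a : Γ} (ha : a • V ⊆ D) : IsBlock h V D 1 (a * h * a⁻¹) :=
  ⟨[a], by simp, by simpa using ha, rfl, by simp⟩

theorem IsBlock.mono (hb : IsBlock h V D n b) (hD : D ⊆ D') : IsBlock h V D' n b := by
  obtain ⟨L, h1, h2, h3, h4⟩ := hb
  exact ⟨L, h1, fun a ha => (h2 a ha).trans hD, h3, h4⟩

theorem IsBlock.mul (hb : IsBlock h V D n b) (hb' : IsBlock h V D' n' b') (hD : Disjoint D D') :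
    IsBlock h V (D ∪ D') (n + n') (b * b') := by
  obtain ⟨L, h1, h2, h3, h4⟩ := hb
  obtain ⟨L', h1', h2', h3', h4'⟩ := hb'
  refine ⟨L ++ L', List.pairwise_append.2 ⟨h1, h1', fun a ha c hc =>
    hD.mono (h2 a ha) (h2' c hc)⟩, fun a ha => ?_, by simp [h3, h3'], by simp [h4, h4']⟩
  rcases List.mem_append.1 ha with ha | ha
  · exact (h2 a ha).trans Set.subset_union_left
  · exact (h2' a ha).trans Set.subset_union_right

theorem IsBlock.conj (hb : IsBlock h V D n b) (a : Γ) :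
    IsBlock h V (a • D) n (a * b * a⁻¹) := by
  obtain ⟨L, h1, h2, h3, h4⟩ := hb
  refine ⟨L.map (a * ·), ?_, ?_, by simpa using h3, ?_⟩
  · rw [List.pairwise_map]
    refine h1.imp fun {c d} hcd => ?_
    rw [mul_smul, mul_smul]
    exact Set.disjoint_smul_set.2 hcd
  · simp only [List.mem_map, forall_exists_index, and_imp, forall_apply_eq_imp_iff₂, mul_smul]
    exact fun c hc => Set.smul_set_mono (h2 c hc)
  · rw [← h4, ← MulAut.conj_apply, map_list_prod, List.map_map, List.map_map]
    congr 2
    funext c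
    simp [MulAut.conj_apply, mul_assoc]

/-- The properties of the action of `Γ` and of an element `h` of order three, supported in `V`,
which force the characters of `Γ` to be constant off the identity. -/
structure IsShiftable [TopologicalSpace X] (h : Γ) (V : Set X) : Prop where
  nonempty : V.Nonempty
  ne_univ : V ≠ Set.univ
  isClopen_smul : ∀ a : Γ, IsClopen (a • V)
  pow_three : h ^ 3 = 1
  comm : ∀ z : Γ, (∀ x ∈ V, z • x = x) → z * h = h * z
  exists_inv : ∃ t : Γ, t • V = V ∧ t * h * t⁻¹ = h⁻¹
  transitive : ∀ n (a a' : Fin n → Γ), (Pairwise fun i j => Disjoint (a i • V) (a j • V)) →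
    (Pairwise fun i j => Disjoint (a' i • V) (a' j • V)) → (⋃ i, a i • V) ≠ Set.univ →
    (⋃ i, a' i • V) ≠ Set.univ → ∃ c : Γ, ∀ i, ∀ x ∈ V, c • a i • x = a' i • x
  room : ∀ D : Set X, IsClopen D → D.Nonempty → ∃ a : ℕ → Γ, (∀ k, a k • V ⊆ D) ∧
    Pairwise fun i j => Disjoint (a i • V) (a j • V)
  normalClosure_eq : Subgroup.normalClosure {h} = ⊤
  displace : ∀ g : Γ, g ≠ 1 → ∃ D : Set X, IsClopen D ∧ D.Nonempty ∧ Disjoint D (g • D) ∧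
    D ∪ g • D ≠ Set.univ

variable [TopologicalSpace X]

/-- Since `h⁻¹` is conjugate to `h` by some `t` preserving `V`, each factor can be inverted by
replacing its conjugator `a` with `a * t`. -/
theorem IsShiftable.block_inv (hs : IsShiftable h V) (hb : IsBlock h V D n b) :
    IsBlock h V D n b⁻¹ := by
  obtain ⟨t, ht, hth⟩ := hs.exists_inv
  obtain ⟨L, h1, h2, h3, h4⟩ := hb
  have hV : ∀ a : Γ, (a * t) • V = a • V := fun a => by rw [mul_smul, ht]
  refine ⟨(L.map (· * t)).reverse, ?_, ?_, by simpa using h3, ?_⟩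
  · rw [List.pairwise_reverse, List.pairwise_map]
    refine h1.imp fun {c d} hcd => ?_
    rw [hV, hV]
    exact hcd.symm
  · simpa [hV] using h2
  · rw [← h4, List.prod_inv_reverse, List.map_reverse, List.map_map, List.map_map]
    congr 3
    funext a
    have : a * t * h * (a * t)⁻¹ = a * (t * h * t⁻¹) * a⁻¹ := by group
    simp only [Function.comp_apply]
    rw [this, hth]
    group

theorem IsShiftable.exists_two (hs : IsShiftable h V) (hD : IsClopen D) (hne : D.Nonempty) :
    ∃ C C' : Set X, IsClopen C ∧ IsClopen C' ∧ C.Nonempty ∧ C'.Nonempty ∧ C ⊆ D ∧ C' ⊆ D ∧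
      Disjoint C C' := by
  obtain ⟨a, ha, hd⟩ := hs.room D hD hne
  exact ⟨a 0 • V, a 1 • V, hs.isClopen_smul _, hs.isClopen_smul _, hs.nonempty.smul_set,
    hs.nonempty.smul_set, ha 0, ha 1, hd zero_ne_one⟩

/-- The pairing function splits one sequence of disjoint translates of `V` into infinitely many
infinite families. -/
theorem IsShiftable.exists_regions (hs : IsShiftable h V) (hD : IsClopen D) (hne : D.Nonempty) :
    ∃ R : ℕ → Set X, (Pairwise fun i j => Disjoint (R i) (R j)) ∧ (∀ k, R k ⊆ D) ∧
      ∀ k n, ∃ b, IsBlock h V (R k) n b := by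
  obtain ⟨a, ha, hd⟩ := hs.room D hD hne
  refine ⟨fun k => ⋃ i, a (Nat.pair k i) • V, fun k l hkl => ?_, fun k => ?_, fun k n => ?_⟩
  · simp only [Set.disjoint_iUnion_left, Set.disjoint_iUnion_right]
    exact fun i j => hd fun h => hkl (Nat.pair_eq_pair.1 h).1
  · exact Set.iUnion_subset fun i => ha _
  · refine ⟨_, (List.range n).map fun i => a (Nat.pair k i), ?_, ?_, by simp, rfl⟩
    · rw [List.pairwise_map]
      exact List.nodup_range.imp fun {i j} hij => hd fun h => hij (Nat.pair_eq_pair.1 h).2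
    · simp only [List.mem_map, forall_exists_index, and_imp, forall_apply_eq_imp_iff₂]
      exact fun i _ => Set.subset_iUnion (fun i => a (Nat.pair k i) • V) i

/-- By `transitive`, a single element matches the translates of `V` in one block with those in the
other, so the blocks are conjugate. -/
theorem IsShiftable.char_eq (hs : IsShiftable h V) {χ : Γ → ℂ} (hχ : IsCharacter χ)
    (hb : IsBlock h V D n b) (hb' : IsBlock h V D' n b') (hD : D ≠ Set.univ)
    (hD' : D' ≠ Set.univ) : χ b = χ b' := by
  obtain ⟨L, h1, h2, h3, rfl⟩ := hb
  obtain ⟨L', h1', h2', h3', rfl⟩ := hb'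
  have hlen : L'.length = L.length := h3'.trans h3.symm
  have key : ∀ (M : List Γ) (E : Set X), M.Pairwise (fun a c => Disjoint (a • V) (c • V)) →
      (∀ a ∈ M, a • V ⊆ E) → E ≠ Set.univ →
      (Pairwise fun i j : Fin M.length => Disjoint (M.get i • V) (M.get j • V)) ∧
      (⋃ i : Fin M.length, M.get i • V) ≠ Set.univ := by
    intro M E h1 h2 hE
    refine ⟨?_, fun h => hE (Set.univ_subset_iff.1 (h ▸ Set.iUnion_subset fun i =>
      h2 _ (List.get_mem _ _)))⟩
    intro i j hij
    rcases lt_or_gt_of_ne hij with h | h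
    · exact List.pairwise_iff_get.1 h1 _ _ h
    · exact (List.pairwise_iff_get.1 h1 _ _ h).symm
  obtain ⟨k1, k2⟩ := key L D h1 h2 hD
  obtain ⟨k1', k2'⟩ := key L' D' h1' h2' hD'
  obtain ⟨c, hc⟩ := hs.transitive L.length L.get (fun i => L'.get (i.cast hlen.symm)) k1
    (fun i j hij => k1' fun h => hij (Fin.cast_injective _ h)) k2 (by
      refine fun h => k2' (Set.univ_subset_iff.1 (h ▸ Set.iUnion_subset fun i => ?_))
      exact Set.subset_iUnion (fun i => L'.get i • V) _)
  rw [← hχ.map_conj c]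
  congr 1
  rw [← MulAut.conj_apply, map_list_prod, List.map_map]
  congr 1
  refine List.ext_getElem (by simp [hlen]) fun i hi hi' => ?_
  simp only [List.getElem_map, Function.comp_apply, MulAut.conj_apply]
  have hi1 : i < L.length := by simpa using hi
  have hci := hc ⟨i, hi1⟩
  simp only [List.get_eq_getElem, Fin.val_cast] at hci
  -- This element fixes `V` pointwise, hence commutes with `h`; so `c` conjugates the `i`-th factor
  -- of one block to that of the other.
  have hz := hs.comm (L'[i]⁻¹ * c * L[i]) fun x hx => by
    rw [mul_smul, mul_smul, hci x hx, inv_smul_smul]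
  calc c * (L[i] * h * L[i]⁻¹) * c⁻¹
      = L'[i] * (L'[i]⁻¹ * c * L[i] * h) * (L'[i]⁻¹ * c * L[i])⁻¹ * L'[i]⁻¹ := by group
    _ = L'[i] * h * L'[i]⁻¹ := by rw [hz]; group

end Blocks

end GroupCharacter

namespace GroupCharacter

open Filter
open scoped InnerProductSpace Pointwise

/-! ### Characters are constant off the identity -/

section Rigidity

variable {Γ : Type u} [Group Γ] {X : Type v} [MulAction Γ X] {h : Γ} {V : Set X}

/-- The vector `e` is a weak limit of the vectors attached to larger and larger blocks in `D`. -/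
def IsBlockLimit {H : Type*} [NormedAddCommGroup H] [InnerProductSpace ℂ H] (h : Γ) (V : Set X)
    (v : Γ → H) (D : Set X) (e : H) : Prop :=
  ∃ (R : ℕ → Set X) (b : ℕ → Γ), (Pairwise fun i j => Disjoint (R i) (R j)) ∧ (∀ k, R k ⊆ D) ∧
    (∀ k, IsBlock h V (R k) (2 * k) (b k)) ∧ IsWeakLimit (fun k => v (b k)) e

theorem IsBlockLimit.mono {H : Type*} [NormedAddCommGroup H] [InnerProductSpace ℂ H] {v : Γ → H}
    {D D' : Set X} {e : H} (he : IsBlockLimit h V v D e) (hD : D ⊆ D') :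
    IsBlockLimit h V v D' e := by
  obtain ⟨R, b, h1, h2, h3⟩ := he
  exact ⟨R, b, h1, fun k => (h2 k).trans hD, h3⟩

variable [TopologicalSpace X]

theorem IsShiftable.exists_regions_ne_univ (hs : IsShiftable h V) :
    ∃ (D : Set X) (R : ℕ → Set X), D ≠ Set.univ ∧
      (Pairwise fun i j => Disjoint (R i) (R j)) ∧ (∀ k, R k ⊆ D) ∧
      ∀ k n, ∃ b, IsBlock h V (R k) n b := by
  have hV : IsClopen V := by simpa using hs.isClopen_smul 1
  obtain ⟨R, h1, h2, h3⟩ := hs.exists_regions hV hs.nonempty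
  exact ⟨V, R, hs.ne_univ, h1, h2, h3⟩

theorem IsShiftable.exists_blockValue (hs : IsShiftable h V) {χ : Γ → ℂ} (hχ : IsCharacter χ) :
    ∃ p : ℕ → ℂ, ∀ (D : Set X) (n : ℕ) (b : Γ), D ≠ Set.univ → IsBlock h V D n b → χ b = p n := by
  obtain ⟨D, R, hD, -, hRD, hR⟩ := hs.exists_regions_ne_univ
  choose b hb using hR 0
  exact ⟨fun n => χ (b n), fun D' n b' hD' hb' =>
    hs.char_eq hχ hb' ((hb n).mono (hRD 0)) hD' hD⟩

theorem norm_eq_one_of_inner {H : Type*} [NormedAddCommGroup H] [InnerProductSpace ℂ H] {x : H}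
    (hx : ⟪x, x⟫_ℂ = 1) : ‖x‖ = 1 := by
  have h := inner_self_eq_norm_sq (𝕜 := ℂ) x
  rw [hx, RCLike.one_re] at h
  nlinarith [norm_nonneg x]

/-- The value at length `2 * j` is the squared norm of two vectors whose inner product is the value
at length `2 * (j + 1)`; monotonicity is Cauchy–Schwarz. -/
theorem IsShiftable.exists_antitone (hs : IsShiftable h V) {χ : Γ → ℂ} (hχ : IsCharacter χ)
    {p : ℕ → ℂ}
    (hp : ∀ (D : Set X) (n : ℕ) (b : Γ), D ≠ Set.univ → IsBlock h V D n b → χ b = p n) :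
    ∃ m : ℕ → ℝ, (∀ j, p (2 * j) = m j) ∧ Antitone m ∧ ∀ j, 0 ≤ m j := by
  obtain ⟨H, _, _, _, v, hv⟩ := hχ.exists_vectors
  have hnorm : ∀ g, ‖v g‖ ≤ 1 := fun g =>
    (norm_eq_one_of_inner (by rw [hv, inv_mul_cancel, hχ.map_one])).le
  obtain ⟨D, R, hD, hRR, hRD, hR⟩ := hs.exists_regions_ne_univ
  have main : ∀ j, ∃ f f' : H, ⟪f, f⟫_ℂ = p (2 * j) ∧ ⟪f', f'⟫_ℂ = p (2 * j) ∧
      ⟪f, f'⟫_ℂ = p (2 * (j + 1)) := by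
    intro j
    choose b hb using fun k => hR k j
    obtain ⟨s, hs0⟩ := hR 0 1
    obtain ⟨s', hs1⟩ := hR 1 1
    -- Regions 0 and 1 are reserved for `s` and `s'`; even and odd indices keep the two sequences
    -- apart. Within one sequence the extra letter cancels; across the two, it adds one letter on
    -- each side.
    obtain ⟨f, hf⟩ := exists_isWeakLimit (fun k => v (s * b (2 * k + 2))) fun _ => hnorm _
    obtain ⟨f', hf'⟩ := exists_isWeakLimit (fun k => v (s' * b (2 * k + 3))) fun _ => hnorm _
    have hsame : ∀ k l, k ≠ l → χ ((b k)⁻¹ * b l) = p (2 * j) := fun k l hkl => by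
      rw [two_mul]
      exact hp D _ _ hD (((hs.block_inv (hb k)).mul (hb l) (hRR hkl)).mono
        (Set.union_subset (hRD _) (hRD _)))
    refine ⟨f, f', hf.inner_eq hf (m := fun _ _ => p (2 * j)) (fun k l hkl => ?_)
        fun _ => tendsto_const_nhds,
      hf'.inner_eq hf' (m := fun _ _ => p (2 * j)) (fun k l hkl => ?_)
        fun _ => tendsto_const_nhds,
      hf.inner_eq hf' (m := fun _ _ => p (2 * (j + 1))) (fun k l hkl => ?_)
        fun _ => tendsto_const_nhds⟩
    · rw [hv, ← hsame (2 * k + 2) (2 * l + 2) (by omega)]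
      congr 1
      group
    · rw [hv, ← hsame (2 * k + 3) (2 * l + 3) (by omega)]
      congr 1
      group
    · rw [hv]
      have h1 := (hs.block_inv (hb (2 * k + 2))).mul (hs.block_inv hs0)
        (hRR (show 2 * k + 2 ≠ 0 by omega))
      have h2 := hs1.mul (hb (2 * l + 3)) (hRR (show 1 ≠ 2 * l + 3 by omega))
      have h3 := h1.mul h2 (by
        simp only [Set.disjoint_union_left, Set.disjoint_union_right]
        refine ⟨⟨hRR ?_, hRR ?_⟩, hRR ?_, hRR ?_⟩ <;> omega)
      rw [mul_inv_rev, show 2 * (j + 1) = j + 1 + (1 + j) by ring]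
      exact hp D _ _ hD (h3.mono (by simp [Set.union_subset_iff, hRD]))
  choose f f' h1 h2 h3 using main
  have e1 : ∀ j, p (2 * j) = ((‖f j‖ ^ 2 : ℝ) : ℂ) := fun j => by
    rw [← h1, inner_self_eq_norm_sq_to_K]; simp
  have e2 : ∀ j, p (2 * j) = ((‖f' j‖ ^ 2 : ℝ) : ℂ) := fun j => by
    rw [← h2, inner_self_eq_norm_sq_to_K]; simp
  refine ⟨fun j => ‖f j‖ ^ 2, e1, antitone_nat_of_succ_le fun j => ?_, fun j => by positivity⟩
  have hff : ‖f' j‖ = ‖f j‖ := by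
    have : ‖f' j‖ ^ 2 = ‖f j‖ ^ 2 := by exact_mod_cast (e2 j).symm.trans (e1 j)
    exact (pow_left_inj₀ (norm_nonneg _) (norm_nonneg _) two_ne_zero).1 this
  have hle := norm_inner_le_norm (𝕜 := ℂ) (f j) (f' j)
  rw [h3, e1 (j + 1), hff, Complex.norm_real, Real.norm_of_nonneg (by positivity)] at hle
  simpa [sq] using hle

theorem IsShiftable.exists_isBlockLimit (hs : IsShiftable h V) {H : Type*} [NormedAddCommGroup H]
    [InnerProductSpace ℂ H] [CompleteSpace H] {v : Γ → H} (hv : ∀ g, ‖v g‖ ≤ 1) {D : Set X}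
    (hD : IsClopen D) (hne : D.Nonempty) : ∃ e, IsBlockLimit h V v D e := by
  obtain ⟨R, h1, h2, h3⟩ := hs.exists_regions hD hne
  choose b hb using fun k => h3 k (2 * k)
  obtain ⟨e, he⟩ := exists_isWeakLimit (fun k => v (b k)) fun _ => hv _
  exact ⟨e, R, b, h1, h2, hb, he⟩

/-- For each character there is a vector which is a weak limit of blocks in every nonempty
clopen set. -/
theorem IsShiftable.exists_limit (hs : IsShiftable h V) {H : Type*} [NormedAddCommGroup H]
    [InnerProductSpace ℂ H] [CompleteSpace H] {v : Γ → H} {χ : Γ → ℂ} (hχ : IsCharacter χ)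
    (hv : ∀ g g', ⟪v g, v g'⟫_ℂ = χ (g⁻¹ * g')) {m : ℕ → ℝ} {c : ℝ}
    (hm : ∀ (D : Set X) (n : ℕ) (b : Γ), D ≠ Set.univ → IsBlock h V D (2 * n) b → χ b = m n)
    (hc : Tendsto m atTop (𝓝 c)) :
    ∃ e : H, ⟪e, e⟫_ℂ = c ∧
      ∀ D : Set X, IsClopen D → D.Nonempty → IsBlockLimit h V v D e := by
  have hnorm : ∀ g, ‖v g‖ ≤ 1 := fun g =>
    (norm_eq_one_of_inner (by rw [hv, inv_mul_cancel, hχ.map_one])).le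
  have hlim : ∀ k, Tendsto (fun l => ((m (k + l) : ℝ) : ℂ)) atTop (𝓝 c) := fun k => by
    refine (Complex.continuous_ofReal.tendsto c).comp (hc.comp ?_)
    simpa [add_comm] using tendsto_add_atTop_nat k
  have hself : ∀ (D : Set X) (e : H), D ≠ Set.univ → IsBlockLimit h V v D e → ⟪e, e⟫_ℂ = c := by
    rintro D e hD ⟨R, b, h1, h2, h3, h4⟩
    refine h4.inner_eq h4 (fun k l hkl => ?_) hlim
    rw [hv]
    refine hm D _ _ hD ?_
    rw [mul_add]
    exact ((hs.block_inv (h3 k)).mul (h3 l) (h1 hkl)).mono (Set.union_subset (h2 k) (h2 l))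
  -- For disjoint regions the mixed products are values on blocks of length `2 * (k + l)` too, so
  -- all three inner products equal `c`.
  have hdisj : ∀ (D D' : Set X) (e e' : H), Disjoint D D' → D ∪ D' ≠ Set.univ →
      IsBlockLimit h V v D e → IsBlockLimit h V v D' e' → e = e' := by
    intro D D' e e' hDD hu he he'
    refine eq_of_inner_eq
      (hself D e (fun h => hu (by rw [h, Set.univ_union])) he)
      (hself D' e' (fun h => hu (by rw [h, Set.union_univ])) he') ?_
    obtain ⟨R, b, h1, h2, h3, h4⟩ := he
    obtain ⟨R', b', h1', h2', h3', h4'⟩ := he'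
    refine h4.inner_eq h4' (fun k l _ => ?_) hlim
    rw [hv]
    refine hm _ _ _ hu ?_
    rw [mul_add]
    exact ((hs.block_inv (h3 k)).mul (h3' l) (hDD.mono (h2 k) (h2' l))).mono
      (Set.union_subset_union (h2 k) (h2' l))
  have hprop : ∀ D D' : Set X, IsClopen D → IsClopen D' → D ∪ D' ≠ Set.univ → ∀ e e' : H,
      IsBlockLimit h V v D e → IsBlockLimit h V v D' e' → e = e' := by
    intro D D' hD hD' hu e e' he he'
    -- Overlapping regions are compared through a third one, `E`, disjoint from both; a point of
    -- `E'` witnesses that the unions with `E` are proper.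
    obtain ⟨E, E', hE, -, hEne, hEne', hEs, hEs', hEE⟩ :=
      hs.exists_two (hD.union hD').compl (Set.nonempty_compl.2 hu)
    obtain ⟨f, hf⟩ := hs.exists_isBlockLimit hnorm hE hEne
    obtain ⟨x, hx⟩ := hEne'
    have hxE : x ∉ E := fun h => hEE.le_bot ⟨h, hx⟩
    have hxD : x ∉ D ∪ D' := hEs' hx
    have hED : Disjoint (D ∪ D') E := Set.disjoint_left.2 fun y hy hyE => hEs hyE hy
    rw [Set.disjoint_union_left] at hED
    rw [hdisj D E e f hED.1 (fun h => ?_) he hf, hdisj D' E e' f hED.2 (fun h => ?_) he' hf]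
    · exact (h ▸ Set.mem_univ x : x ∈ D' ∪ E).elim (fun h => hxD (Or.inr h)) hxE
    · exact (h ▸ Set.mem_univ x : x ∈ D ∪ E).elim (fun h => hxD (Or.inl h)) hxE
  have hV : IsClopen V := by simpa using hs.isClopen_smul 1
  obtain ⟨e, he⟩ := hs.exists_isBlockLimit hnorm hV hs.nonempty
  refine ⟨e, hself V e hs.ne_univ he, fun D hD hne => ?_⟩
  obtain ⟨C, C', hC, hC', hCne, hCne', hCs, hCs', hCC⟩ := hs.exists_two hD hne
  obtain ⟨E, hE, hEne, hED, hEV⟩ : ∃ E : Set X, IsClopen E ∧ E.Nonempty ∧ E ⊆ D ∧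
      V ∪ E ≠ Set.univ := by
    -- If `V` and `C` cover the space, then `C'`, being disjoint from `C`, lies in `V`, and `V ∪ C'
    -- = V` is proper.
    by_cases hu : V ∪ C = Set.univ
    · refine ⟨C', hC', hCne', hCs', fun h => hs.ne_univ ?_⟩
      rwa [Set.union_eq_self_of_subset_right] at h
      exact fun x hx => (hu ▸ Set.mem_univ x : x ∈ V ∪ C).resolve_right
        fun hxC => hCC.le_bot ⟨hxC, hx⟩
    · exact ⟨C, hC, hCne, hCs, hu⟩
  obtain ⟨f, hf⟩ := hs.exists_isBlockLimit hnorm hE hEne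
  rw [hprop V E hV hE hEV e f he hf]
  exact hf.mono hED

/-- Translation by a block of two letters fixes the limit vector. -/
theorem IsShiftable.inner_limit_block (hs : IsShiftable h V) {H : Type*} [NormedAddCommGroup H]
    [InnerProductSpace ℂ H] [CompleteSpace H] {v : Γ → H} {χ : Γ → ℂ} (hχ : IsCharacter χ)
    (hv : ∀ g g', ⟪v g, v g'⟫_ℂ = χ (g⁻¹ * g')) {m : ℕ → ℝ} {c : ℝ}
    (hm : ∀ (D : Set X) (n : ℕ) (b : Γ), D ≠ Set.univ → IsBlock h V D (2 * n) b → χ b = m n)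
    (hc : Tendsto m atTop (𝓝 c)) {e : H} (hee : ⟪e, e⟫_ℂ = c)
    (he : ∀ D : Set X, IsClopen D → D.Nonempty → IsBlockLimit h V v D e) {S : Set X}
    (hS : IsClopen S) (hSu : S ≠ Set.univ) {s : Γ} (hb : IsBlock h V S 2 s) (g : Γ) :
    ⟪e, v (s * g)⟫_ℂ = ⟪e, v g⟫_ℂ := by
  have hnorm : ∀ g, ‖v g‖ ≤ 1 := fun g =>
    (norm_eq_one_of_inner (by rw [hv, inv_mul_cancel, hχ.map_one])).le
  have hlim : ∀ k, Tendsto (fun l => ((m (k + l) : ℝ) : ℂ)) atTop (𝓝 c) := fun k => by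
    refine (Complex.continuous_ofReal.tendsto c).comp (hc.comp ?_)
    simpa [add_comm] using tendsto_add_atTop_nat k
  obtain ⟨C, C', hC, -, hCne, ⟨x, hx⟩, hCs, hCs', hCC⟩ :=
    hs.exists_two hS.compl (Set.nonempty_compl.2 hSu)
  have hxC : x ∉ S ∪ C := fun h => h.elim (hCs' hx) fun h => hCC.le_bot ⟨h, hx⟩
  have hu : S ∪ C ≠ Set.univ := fun h => hxC (h ▸ Set.mem_univ x)
  have hSC : Disjoint S C := Set.disjoint_left.2 fun y hy hyC => hCs hyC hy
  obtain ⟨R, b, h1, h2, h3, h4⟩ := he C hC hCne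
  obtain ⟨f, hf⟩ := exists_isWeakLimit (fun k => v (s⁻¹ * b k)) fun _ => hnorm _
  -- The vector `e` is realised by blocks off `S`, so inserting the two letters of `s` only shifts
  -- the half-length by one, which does not change the limit `c`.
  have hfe : f = e := by
    refine eq_of_inner_eq (hf.inner_eq hf (fun k l hkl => ?_) hlim) hee
      (hf.inner_eq h4 (m := fun k l => m (k + 1 + l)) (fun k l hkl => ?_) fun k => hlim (k + 1))
    · rw [hv, show (s⁻¹ * b k)⁻¹ * (s⁻¹ * b l) = (b k)⁻¹ * b l by group]
      refine hm _ _ _ hu ?_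
      rw [mul_add]
      exact ((hs.block_inv (h3 k)).mul (h3 l) (h1 hkl)).mono
        ((Set.union_subset (h2 k) (h2 l)).trans Set.subset_union_right)
    · rw [hv, show (s⁻¹ * b k)⁻¹ * b l = (b k)⁻¹ * s * b l by group]
      refine hm _ _ _ hu ?_
      rw [mul_add, mul_add]
      refine ((hs.block_inv (h3 k)).mul hb (hSC.symm.mono_left (h2 k))).mul (h3 l) ?_ |>.mono ?_
      · exact Set.disjoint_union_left.2 ⟨h1 hkl, hSC.mono_right (h2 l)⟩
      · exact Set.union_subset (Set.union_subset ((h2 k).trans Set.subset_union_right)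
          Set.subset_union_left) ((h2 l).trans Set.subset_union_right)
  rw [hfe] at hf
  refine tendsto_nhds_unique (h4 (v (s * g))) ((hf (v g)).congr fun k => ?_)
  rw [hv, hv]
  congr 1
  group

/-- The stabilising elements form a subgroup. If `x` and `y` are conjugates of `h` with disjoint
supports and proper union, it contains `x * y` and `y⁻¹ * x`, hence `x²`, hence `x = x⁴` because `h`
has order three. So it contains the normal closure of `h`. -/
theorem IsShiftable.inner_limit_const (hs : IsShiftable h V) {H : Type*} [NormedAddCommGroup H]
    [InnerProductSpace ℂ H] {v : Γ → H} {e : H}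
    (hinv : ∀ (S : Set X) (s : Γ), IsClopen S → S ≠ Set.univ → IsBlock h V S 2 s → ∀ g,
      ⟪e, v (s * g)⟫_ℂ = ⟪e, v g⟫_ℂ) (g : Γ) : ⟪e, v g⟫_ℂ = ⟪e, v 1⟫_ℂ := by
  let N : Subgroup Γ :=
    { carrier := {a | ∀ g, ⟪e, v (a * g)⟫_ℂ = ⟪e, v g⟫_ℂ}
      one_mem' := fun g => by rw [one_mul]
      mul_mem' := fun {a b} ha hb g => by rw [mul_assoc, ha, hb]
      inv_mem' := fun {a} ha g => by rw [← ha, mul_inv_cancel_left] }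
  have hN : Subgroup.normalClosure {h} ≤ N := by
    refine (Subgroup.closure_le _).2 fun x hx => ?_
    obtain ⟨h', hh', hx'⟩ := Group.mem_conjugatesOfSet_iff.1 hx
    rw [Set.mem_singleton_iff.1 hh'] at hx'
    obtain ⟨a, rfl⟩ := isConj_iff.1 hx'
    have ha : a • V ≠ Set.univ := fun h' => hs.ne_univ (by
      rw [← inv_smul_smul a V, h', Set.smul_set_univ])
    obtain ⟨C, C', hC, -, hCne, ⟨x, hx⟩, hCs, hCs', hCC⟩ :=
      hs.exists_two (hs.isClopen_smul a).compl (Set.nonempty_compl.2 ha)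
    have hxC : x ∉ a • V ∪ C := fun h => h.elim (hCs' hx) fun h => hCC.le_bot ⟨h, hx⟩
    have hu : a • V ∪ C ≠ Set.univ := fun h => hxC (h ▸ Set.mem_univ x)
    have hSC : Disjoint (a • V) C := Set.disjoint_left.2 fun y hy hyC => hCs hyC hy
    obtain ⟨b, hb, -⟩ := hs.room C hC hCne
    have hba := isBlock_single (h := h) (hb 0)
    have haa := isBlock_single (h := h) (subset_refl (a • V))
    have hcl := (hs.isClopen_smul a).union hC
    have m1 : a * h * a⁻¹ * (b 0 * h * (b 0)⁻¹) ∈ N := hinv _ _ hcl hu (haa.mul hba hSC)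
    have m2 : (b 0 * h * (b 0)⁻¹)⁻¹ * (a * h * a⁻¹) ∈ N := by
      refine hinv _ _ hcl hu ?_
      rw [Set.union_comm]
      exact (hs.block_inv hba).mul haa hSC.symm
    have m3 := N.mul_mem m1 m2
    have h3 : h * h * (h * h) = h := by
      have := hs.pow_three
      calc h * h * (h * h) = h ^ 3 * h := by simp only [pow_succ, pow_zero, one_mul, mul_assoc]
        _ = h := by rw [this, one_mul]
    have h4 : a * h * a⁻¹ * (b 0 * h * (b 0)⁻¹) * ((b 0 * h * (b 0)⁻¹)⁻¹ * (a * h * a⁻¹)) *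
        (a * h * a⁻¹ * (b 0 * h * (b 0)⁻¹) * ((b 0 * h * (b 0)⁻¹)⁻¹ * (a * h * a⁻¹))) =
        a * (h * h * (h * h)) * a⁻¹ := by group
    rw [h3] at h4
    exact h4 ▸ N.mul_mem m3 m3
  have := hN (hs.normalClosure_eq ▸ Subgroup.mem_top g) 1
  rwa [mul_one] at this

/-- Characters of a group with a shiftable element are constant off the identity. -/
theorem IsShiftable.character_const (hs : IsShiftable h V) {χ : Γ → ℂ} (hχ : IsCharacter χ) :
    ∃ c : ℝ, 0 ≤ c ∧ ∀ g, g ≠ 1 → χ g = c := by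
  obtain ⟨p, hp⟩ := hs.exists_blockValue hχ
  obtain ⟨m, hpm, hanti, hnn⟩ := hs.exists_antitone hχ hp
  have hm : ∀ (D : Set X) (n : ℕ) (b : Γ), D ≠ Set.univ → IsBlock h V D (2 * n) b → χ b = m n :=
    fun D n b hD hb => (hp D _ b hD hb).trans (hpm n)
  have hbdd : BddBelow (Set.range m) := ⟨0, Set.forall_mem_range.2 hnn⟩
  obtain ⟨c, hc⟩ : ∃ c, Tendsto m atTop (𝓝 c) := ⟨_, tendsto_atTop_ciInf hanti hbdd⟩
  obtain ⟨H, _, _, _, v, hv⟩ := hχ.exists_vectors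
  have hnorm : ∀ g, ‖v g‖ ≤ 1 := fun g =>
    (norm_eq_one_of_inner (by rw [hv, inv_mul_cancel, hχ.map_one])).le
  obtain ⟨e, hee, he⟩ := hs.exists_limit hχ hv hm hc
  have hconst := hs.inner_limit_const (v := v) (e := e) fun S s hS hSu hb g =>
    hs.inner_limit_block hχ hv hm hc hee he hS hSu hb g
  have hV : IsClopen V := by simpa using hs.isClopen_smul 1
  -- The constant is found by evaluating at the blocks that converge to `e`, where the limit is `⟪e,
  -- e⟫`.
  have hev : ∀ g, ⟪e, v g⟫_ℂ = c := by
    obtain ⟨R, b, -, -, -, h4⟩ := he V hV hs.nonempty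
    have := h4.tendsto_right e
    rw [hee] at this
    intro g
    rw [hconst]
    exact tendsto_nhds_unique (tendsto_const_nhds.congr fun k => (hconst (b k)).symm) this
  refine ⟨c, ge_of_tendsto' hc hnn, fun g hg => ?_⟩
  obtain ⟨D, hD, hne, hdis, hu⟩ := hs.displace g hg
  obtain ⟨R, b, h1, h2, h3, -⟩ := he D hD hne
  obtain ⟨f, hf⟩ := exists_isWeakLimit (fun k => v (b k * g⁻¹ * (b k)⁻¹)) fun _ => hnorm _
  have hfe : f = e := by
    refine eq_of_inner_eq (hf.inner_eq hf (m := fun k l => m (2 * (k + l))) (fun k l hkl => ?_)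
      fun k => ?_) hee ?_
    -- Up to conjugation the argument of `χ` splits into a block in `g • D` times a block in `D`,
    -- each of length `2 * k + 2 * l`; displacement makes the product a block.
    · rw [hv, ← hχ.map_conj (b k)⁻¹, show (b k)⁻¹ * ((b k * g⁻¹ * (b k)⁻¹)⁻¹ *
        (b l * g⁻¹ * (b l)⁻¹)) * (b k)⁻¹⁻¹ =
        (g * ((b k)⁻¹ * b l) * g⁻¹) * ((b l)⁻¹ * b k) by group]
      refine hm _ _ _ hu ?_
      have b1 := ((hs.block_inv (h3 k)).mul (h3 l) (h1 hkl)).mono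
        (Set.union_subset (h2 k) (h2 l))
      have b2 := ((hs.block_inv (h3 l)).mul (h3 k) (h1 hkl.symm)).mono
        (Set.union_subset (h2 l) (h2 k))
      rw [Set.union_comm, show 2 * (2 * (k + l)) = 2 * k + 2 * l + (2 * l + 2 * k) by ring]
      exact (b1.conj g).mul b2 hdis.symm
    · refine (Complex.continuous_ofReal.tendsto c).comp (hc.comp ?_)
      exact tendsto_atTop_mono (fun l => by simp only [id]; omega) tendsto_id
    · refine tendsto_nhds_unique (hf e) (tendsto_const_nhds.congr fun k => ?_)
      rw [← inner_conj_symm, hev, Complex.conj_ofReal]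
  rw [← hev 1, ← hfe]
  refine tendsto_nhds_unique (tendsto_const_nhds.congr fun k => ?_) (hf (v 1))
  rw [hv, ← hχ.map_conj (b k) g]
  congr 1
  group

/-! ### The identity and regular characters as extreme points -/

theorem isCharacter_identityCharacter : IsCharacter (identityCharacter Γ) where
  map_mul_comm _ _ := rfl
  map_one := rfl
  posSemidef n g := by
    have := Matrix.posSemidef_conjTranspose_mul_self (Matrix.of fun (_ : Unit) (_ : Fin n) => (1 : ℂ))
    convert this using 1
    ext i j
    simp [identityCharacter, Matrix.mul_apply]

theorem isCharacter_regularCharacter : IsCharacter (regularCharacter Γ) where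
  map_mul_comm g g' := by
    simp only [regularCharacter]
    congr 1
    rw [mul_eq_one_iff_eq_inv, mul_eq_one_iff_inv_eq, eq_iff_iff, eq_comm]
  map_one := by simp [regularCharacter]
  posSemidef n g := by
    classical
    -- The matrix is the Gram matrix of the indicator vectors of the `g i`.
    have := Matrix.posSemidef_conjTranspose_mul_self
      (Matrix.of fun (x : Finset.univ.image g) (i : Fin n) => if g i = x then (1 : ℂ) else 0)
    convert this using 1
    ext i j
    rw [Matrix.mul_apply, Finset.sum_eq_single ⟨g i, Finset.mem_image_of_mem _ (Finset.mem_univ _)⟩]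
    · simp [regularCharacter, mul_inv_eq_one, eq_comm]
    · rintro ⟨x, hx⟩ - hne
      have : g i ≠ x := fun h => hne (Subtype.ext h.symm)
      simp [this]
    · simp

theorem IsCharacter.le_one {χ : Γ → ℂ} (hχ : IsCharacter χ) (g : Γ) : ‖χ g‖ ≤ 1 := by
  obtain ⟨H, _, _, _, v, hv⟩ := hχ.exists_vectors
  have hnorm : ∀ g, ‖v g‖ = 1 := fun g =>
    norm_eq_one_of_inner (by rw [hv, inv_mul_cancel, hχ.map_one])
  have := norm_inner_le_norm (𝕜 := ℂ) (v 1) (v g)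
  simpa [hv, hnorm] using this

theorem IsShiftable.hasNoProperCharacters (hs : IsShiftable h V) : HasNoProperCharacters Γ := by
  intro χ
  -- The simplex of characters is a segment with parameter `c`. In the trivial group both endpoints
  -- coincide and `c = 1` is an arbitrary choice.
  have hconv : ∀ (χ' : Γ → ℂ), IsCharacter χ' → ∃ c : ℝ, 0 ≤ c ∧ c ≤ 1 ∧ (∀ g, g ≠ 1 → χ' g = c) ∧
      ∀ g, χ' g = c * identityCharacter Γ g + (1 - c) * regularCharacter Γ g := by
    intro χ' hχ'
    by_cases hΓ : ∃ g : Γ, g ≠ 1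
    · obtain ⟨g₀, hg₀⟩ := hΓ
      obtain ⟨c, hc0, hc⟩ := hs.character_const hχ'
      refine ⟨c, hc0, ?_, hc, fun g => ?_⟩
      · have := hχ'.le_one g₀
        rwa [hc _ hg₀, Complex.norm_real, Real.norm_of_nonneg hc0] at this
      · by_cases hg : g = 1
        · simp [hg, hχ'.map_one, identityCharacter, regularCharacter]
        · simp [hg, hc _ hg, identityCharacter, regularCharacter]
    · push Not at hΓ
      refine ⟨1, zero_le_one, le_rfl, fun g hg => (hg (hΓ g)).elim, fun g => ?_⟩
      simp [hΓ g, hχ'.map_one, identityCharacter]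
  constructor
  · rintro ⟨hχ, hind⟩
    obtain ⟨c, hc0, hc1, hc, hcχ⟩ := hconv χ hχ
    by_contra hne
    push Not at hne
    refine hind ⟨_, _, isCharacter_identityCharacter, isCharacter_regularCharacter,
      fun heq => hne.1 ?_, c, lt_of_le_of_ne hc0 ?_, lt_of_le_of_ne hc1 ?_, hcχ⟩
    · funext g
      rw [hcχ, ← heq]
      ring
    · rintro rfl
      exact hne.2 (funext fun g => by rw [hcχ]; simp)
    · rintro rfl
      exact hne.1 (funext fun g => by rw [hcχ]; simp)
  · rintro (rfl | rfl)
    · refine ⟨isCharacter_identityCharacter, ?_⟩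
      rintro ⟨χ₁, χ₂, h1, h2, hne, t, ht0, ht1, ht⟩
      obtain ⟨c₁, -, k1, l1, e1⟩ := hconv χ₁ h1
      obtain ⟨c₂, -, k2, l2, e2⟩ := hconv χ₂ h2
      refine hne (funext fun g => ?_)
      by_cases hg : g = 1
      · rw [hg, h1.map_one, h2.map_one]
      · have := ht g
        rw [l1 g hg, l2 g hg, identityCharacter] at this
        have : (1 : ℝ) = t * c₁ + (1 - t) * c₂ := by exact_mod_cast this
        have a1 : c₁ = 1 := by nlinarith
        have a2 : c₂ = 1 := by nlinarith
        rw [l1 g hg, l2 g hg, a1, a2]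
    · refine ⟨isCharacter_regularCharacter, ?_⟩
      rintro ⟨χ₁, χ₂, h1, h2, hne, t, ht0, ht1, ht⟩
      obtain ⟨c₁, k1, -, l1, e1⟩ := hconv χ₁ h1
      obtain ⟨c₂, k2, -, l2, e2⟩ := hconv χ₂ h2
      refine hne (funext fun g => ?_)
      by_cases hg : g = 1
      · rw [hg, h1.map_one, h2.map_one]
      · have := ht g
        rw [l1 g hg, l2 g hg, regularCharacter, if_neg hg] at this
        have : (0 : ℝ) = t * c₁ + (1 - t) * c₂ := by exact_mod_cast this
        have a1 : c₁ = 0 := by nlinarith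
        have a2 : c₂ = 0 := by nlinarith
        rw [l1 g hg, l2 g hg, a1, a2]

end Rigidity

end GroupCharacter

namespace TopGroupoid

open Filter

/-! ### Maps given locally by arrows, and clopen embeddings -/

section Germs

variable {X : Type u} [TopologicalSpace X] [Groupoid.{v} X] [TopologicalSpace (Arrow X)]

/-- Near `x`, the map `f` is given by a continuous family of arrows. -/
def IsLocal (f : X → X) (x : X) : Prop :=
  ∃ (ρ : X → Arrow X) (W : Set X), IsOpen W ∧ x ∈ W ∧ ContinuousOn ρ W ∧
    ∀ y ∈ W, (ρ y).left = y ∧ (ρ y).right = f y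

variable {f g : X → X} {x : X}

theorem IsLocal.congr (hf : IsLocal f x) (h : f =ᶠ[𝓝 x] g) : IsLocal g x := by
  obtain ⟨ρ, W, hW, hx, hρ, h1⟩ := hf
  obtain ⟨W', h', hW', hx'⟩ := mem_nhds_iff.1 h
  exact ⟨ρ, W ∩ W', hW.inter hW', ⟨hx, hx'⟩, hρ.mono Set.inter_subset_left, fun y hy =>
    ⟨(h1 y hy.1).1, (h1 y hy.1).2.trans (h' hy.2)⟩⟩

theorem isLocal_of_openPartialHomeomorph (e : OpenPartialHomeomorph (Arrow X) X)
    (he : (fun γ : Arrow X => (γ.left : X)) = e) (hx : x ∈ e.target) :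
    IsLocal (fun y => (e.symm y).right) x := by
  refine ⟨e.symm, e.target, e.open_target, hx, e.continuousOn_symm, fun y hy => ⟨?_, rfl⟩⟩
  exact (congrFun he (e.symm y)).trans (e.right_inv hy)

theorem IsLocal.eventually (hf : IsLocal f x) : ∀ᶠ y in 𝓝 x, IsLocal f y := by
  obtain ⟨ρ, W, hW, hx, hρ, h1⟩ := hf
  filter_upwards [hW.mem_nhds hx] with y hy using ⟨ρ, W, hW, hy, hρ, h1⟩

/-- A map which is given by arrows near each point of the clopen set `U`, and injective on `U`. -/
structure IsEmb (f : X → X) (U : Set X) : Prop where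
  isClopen : IsClopen U
  isLocal : ∀ x ∈ U, IsLocal f x
  injOn : Set.InjOn f U

variable {U V D : Set X}

theorem IsEmb.mono (hf : IsEmb f U) (hV : IsClopen V) (hVU : V ⊆ U) : IsEmb f V :=
  ⟨hV, fun x hx => hf.isLocal x (hVU hx), hf.injOn.mono hVU⟩

open Classical in
theorem IsEmb.piecewise (hf : IsEmb f U) (hg : IsEmb g V) (hUV : Disjoint U V)
    (h : Disjoint (f '' U) (g '' V)) : IsEmb (U.piecewise f g) (U ∪ V) := by
  refine ⟨hf.isClopen.union hg.isClopen, ?_, ?_⟩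
  · intro x hx
    by_cases hxU : x ∈ U
    · refine (hf.isLocal x hxU).congr ?_
      filter_upwards [hf.isClopen.isOpen.mem_nhds hxU] with y hy
      exact (Set.piecewise_eq_of_mem _ _ _ hy).symm
    · refine (hg.isLocal x (hx.resolve_left hxU)).congr ?_
      filter_upwards [hf.isClopen.compl.isOpen.mem_nhds hxU] with y hy
      exact (Set.piecewise_eq_of_notMem _ _ _ hy).symm
  · rw [Set.injOn_union hUV]
    have h1 : Set.EqOn (U.piecewise f g) f U := U.piecewise_eqOn f g
    have h2 : Set.EqOn (U.piecewise f g) g V := fun x hx =>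
      Set.piecewise_eq_of_notMem _ _ _ fun hxU => hUV.le_bot ⟨hxU, hx⟩
    refine ⟨h1.injOn_iff.2 hf.injOn, h2.injOn_iff.2 hg.injOn, fun x hx y hy hxy => ?_⟩
    rw [h1 hx, h2 hy] at hxy
    exact h.le_bot ⟨⟨x, hx, rfl⟩, ⟨y, hy, hxy.symm⟩⟩

variable [EtaleGroupoid X]

theorem isLocal_id (x : X) : IsLocal id x :=
  ⟨unit, Set.univ, isOpen_univ, trivial,
    TopologicalGroupoid.isEmbedding_unit.continuous.continuousOn, fun _ _ => ⟨rfl, rfl⟩⟩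

theorem IsLocal.continuousAt (hf : IsLocal f x) : ContinuousAt f x := by
  obtain ⟨ρ, W, hW, hx, hρ, h1⟩ := hf
  have hr : Continuous (fun γ : Arrow X => (γ.right : X)) :=
    EtaleGroupoid.isLocalHomeomorph_range.continuous
  exact ((hr.comp_continuousOn hρ).congr fun y hy => (h1 y hy).2.symm).continuousAt
    (hW.mem_nhds hx)

theorem IsLocal.comp (hg : IsLocal g (f x)) (hf : IsLocal f x) : IsLocal (g ∘ f) x := by
  obtain ⟨ρ, W, hW, hx, hρ, h1⟩ := id hf
  obtain ⟨σ, W', hW', hx', hσ, h2⟩ := hg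
  have hfW : ContinuousOn f W := fun y hy =>
    (IsLocal.continuousAt ⟨ρ, W, hW, hy, hρ, h1⟩).continuousWithinAt
  classical
  refine ⟨fun y => if h : (ρ y).right = (σ (f y)).left then mul (σ (f y)) (ρ y) h else ρ y,
    W ∩ f ⁻¹' W', hfW.isOpen_inter_preimage hW hW', ⟨hx, hx'⟩, ?_, fun y hy => ?_⟩
  · rw [continuousOn_iff_continuous_domRestrict]
    have hcomp : ∀ y : ↥(W ∩ f ⁻¹' W'), (ρ y).right = (σ (f y)).left := fun y => by
      rw [(h1 y y.2.1).2, (h2 _ y.2.2).1]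
    have c1 : Continuous fun y : ↥(W ∩ f ⁻¹' W') => ρ y :=
      continuousOn_iff_continuous_domRestrict.1 (hρ.mono Set.inter_subset_left)
    have c2 : Continuous fun y : ↥(W ∩ f ⁻¹' W') => σ (f y) :=
      continuousOn_iff_continuous_domRestrict.1
        (hσ.comp (hfW.mono Set.inter_subset_left) fun y hy => hy.2)
    refine (TopologicalGroupoid.continuous_mul.comp
      ((c2.prodMk c1).subtype_mk fun y => hcomp y)).congr fun y => ?_
    simp [hcomp y]
  · have h : (ρ y).right = (σ (f y)).left := by rw [(h1 y hy.1).2, (h2 _ hy.2).1]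
    simp only [h, dif_pos]
    exact ⟨(h1 y hy.1).1, (h2 _ hy.2).2⟩

/-- A continuous section of the source map agrees near `x` with a local inverse of that map, so it
is open at `x`. Composing with the range map then shows that `f` is open and injective near `x`. -/
theorem IsLocal.exists_section (hf : IsLocal f x) :
    ∃ ρ : X → Arrow X, map ρ (𝓝 x) = 𝓝 (ρ x) ∧
      ∀ᶠ y in 𝓝 x, (ρ y).left = y ∧ (ρ y).right = f y := by
  obtain ⟨ρ, W, hW, hx, hρ, h1⟩ := hf
  obtain ⟨e, hex, he⟩ := (EtaleGroupoid.isLocalHomeomorph_source (X := X)) (ρ x)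
  refine ⟨ρ, ?_, by filter_upwards [hW.mem_nhds hx] with y hy using h1 y hy⟩
  have hxe : e (ρ x) = x := by rw [← he]; exact (h1 x hx).1
  have hxt : x ∈ e.target := hxe ▸ e.map_source hex
  have hsx : e.symm x = ρ x := by rw [← e.left_inv hex, hxe]
  have hev : ρ =ᶠ[𝓝 x] e.symm := by
    filter_upwards [hW.mem_nhds hx, (hρ.continuousAt (hW.mem_nhds hx)).preimage_mem_nhds
      (e.open_source.mem_nhds hex)] with y hy hye
    have : e (ρ y) = y := by rw [← he]; exact (h1 y hy).1
    conv_rhs => rw [← this]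
    exact (e.left_inv hye).symm
  rw [Filter.map_congr hev, ← hsx]
  exact e.symm.map_nhds_eq hxt

theorem IsLocal.map_nhds_eq (hf : IsLocal f x) : map f (𝓝 x) = 𝓝 (f x) := by
  obtain ⟨ρ, h1, h2⟩ := hf.exists_section
  have h3 : f =ᶠ[𝓝 x] (fun γ : Arrow X => (γ.right : X)) ∘ ρ := h2.mono fun y hy => hy.2.symm
  rw [Filter.map_congr h3, ← Filter.map_map, h1,
    (EtaleGroupoid.isLocalHomeomorph_range (X := X)).map_nhds_eq, ← h2.self_of_nhds.2]

theorem IsLocal.exists_injOn (hf : IsLocal f x) : ∃ W ∈ 𝓝 x, Set.InjOn f W := by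
  obtain ⟨ρ, h1, h2⟩ := hf.exists_section
  obtain ⟨e, hex, he⟩ := (EtaleGroupoid.isLocalHomeomorph_range (X := X)) (ρ x)
  have h3 : Tendsto ρ (𝓝 x) (𝓝 (ρ x)) := h1.le
  refine ⟨_, h2.and (h3 (e.open_source.mem_nhds hex)), ?_⟩
  rintro y ⟨hy, hye⟩ z ⟨hz, hze⟩ hyz
  have h4 : ρ y = ρ z := e.injOn hye hze (by
    rw [← he]; exact hy.2.trans (hyz.trans hz.2.symm))
  rw [← hy.1, h4, hz.1]

/-- The inverse germ is given by the inverse arrows; openness of `f` makes `g` continuous near `f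
x`. -/
theorem IsLocal.symm (hf : IsLocal f x) (h : ∀ᶠ y in 𝓝 x, g (f y) = y) : IsLocal g (f x) := by
  obtain ⟨ρ, W, hW, hx, hρ, h1⟩ := id hf
  obtain ⟨W', h', hW', hx'⟩ := mem_nhds_iff.1 h
  have hloc : ∀ y ∈ W ∩ W', IsLocal f y := fun y hy => ⟨ρ, W, hW, hy.1, hρ, h1⟩
  have hg : ContinuousOn g (f '' (W ∩ W')) := by
    rintro _ ⟨y, hy, rfl⟩
    refine ContinuousAt.continuousWithinAt ?_
    have hev : g ∘ f =ᶠ[𝓝 y] id := by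
      filter_upwards [hW'.mem_nhds hy.2] with z hz using h' hz
    rw [ContinuousAt, ← (hloc y hy).map_nhds_eq, tendsto_map'_iff, h' hy.2]
    exact tendsto_id.congr' hev.symm
  refine ⟨fun z => inv (ρ (g z)), f '' (W ∩ W'), ?_, ⟨x, ⟨hx, hx'⟩, rfl⟩, ?_, ?_⟩
  · rw [isOpen_iff_mem_nhds]
    rintro _ ⟨y, hy, rfl⟩
    rw [← (hloc y hy).map_nhds_eq]
    exact image_mem_map ((hW.inter hW').mem_nhds hy)
  · refine TopologicalGroupoid.continuous_inv.comp_continuousOn (hρ.comp hg ?_)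
    rintro _ ⟨y, hy, rfl⟩
    rw [h' hy.2]
    exact hy.1
  · rintro _ ⟨y, hy, rfl⟩
    change (ρ (g (f y))).right = f y ∧ (ρ (g (f y))).left = g (f y)
    rw [h' hy.2]
    exact ⟨(h1 y hy.1).2, (h1 y hy.1).1⟩

theorem isLocal_of_mem_fullGroup [CompactSpace X] {φ : X ≃ₜ X} (hφ : φ ∈ fullGroup X) (x : X) :
    IsLocal φ x := by
  obtain ⟨ρ, hρ, hl, hr⟩ := (isGivenByFullBisection_iff_section φ).1 hφ
  exact ⟨ρ, Set.univ, isOpen_univ, trivial, hρ.continuousOn, fun y _ => ⟨hl y, hr y⟩⟩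

/-- By compactness and zero-dimensionality, local families of arrows can be cut to finitely many
clopen pieces and glued into one global section. -/
theorem mem_fullGroup_of_isLocal [CompactSpace X] [T2Space X] [TotallyDisconnectedSpace X]
    {φ : X ≃ₜ X} (hφ : ∀ x, IsLocal φ x) : φ ∈ fullGroup X := by
  have key : ∃ U : Set X, Set.univ ⊆ U ∧ IsClopen U ∧ ∃ ρ : X → Arrow X, ContinuousOn ρ U ∧
      ∀ y ∈ U, (ρ y).left = y ∧ (ρ y).right = φ y := by
    refine isCompact_univ.induction_on (p := fun S => ∃ U : Set X, S ⊆ U ∧ IsClopen U ∧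
      ∃ ρ : X → Arrow X, ContinuousOn ρ U ∧ ∀ y ∈ U, (ρ y).left = y ∧ (ρ y).right = φ y)
      ⟨∅, subset_rfl, isClopen_empty, unit, continuousOn_empty _, by simp⟩
      (fun S T hST ⟨U, h1, h2⟩ => ⟨U, hST.trans h1, h2⟩) ?_ ?_
    · rintro S T ⟨U, hSU, hU, ρ, hρ, h1⟩ ⟨U', hTU, hU', ρ', hρ', h1'⟩
      classical
      refine ⟨U ∪ U', Set.union_subset_union hSU hTU, hU.union hU', U.piecewise ρ ρ', ?_, ?_⟩
      · have c1 : ContinuousOn (U.piecewise ρ ρ') U :=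
          hρ.congr fun y hy => Set.piecewise_eq_of_mem _ _ _ hy
        have c2 : ContinuousOn (U.piecewise ρ ρ') (U' \ U) :=
          (hρ'.mono Set.sdiff_subset).congr fun y hy => Set.piecewise_eq_of_notMem _ _ _ hy.2
        rw [← Set.union_sdiff_self]
        exact c1.union_of_isOpen c2 hU.isOpen (hU'.isOpen.sdiff hU.isClosed)
      · intro y hy
        by_cases hyU : y ∈ U
        · rw [Set.piecewise_eq_of_mem _ _ _ hyU]
          exact h1 y hyU
        · rw [Set.piecewise_eq_of_notMem _ _ _ hyU]
          exact h1' y (hy.resolve_left hyU)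
    · intro x _
      obtain ⟨ρ, W, hW, hx, hρ, h1⟩ := hφ x
      obtain ⟨U, hU, hxU, hUW⟩ := compact_exists_isClopen_in_isOpen hW hx
      exact ⟨U, mem_nhdsWithin_of_mem_nhds (hU.isOpen.mem_nhds hxU), U, subset_rfl, hU, ρ,
        hρ.mono hUW, fun y hy => h1 y (hUW hy)⟩
  obtain ⟨U, hU, -, ρ, hρ, h1⟩ := key
  rw [Set.univ_subset_iff] at hU
  subst hU
  exact (isGivenByFullBisection_iff_section φ).2 ⟨ρ, continuousOn_univ.1 hρ,
    fun x => (h1 x trivial).1, fun x => (h1 x trivial).2⟩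

theorem IsEmb.comp (hg : IsEmb g V) (hf : IsEmb f U) (h : Set.MapsTo f U V) : IsEmb (g ∘ f) U :=
  ⟨hf.isClopen, fun x hx => (hg.isLocal _ (h hx)).comp (hf.isLocal x hx), hg.injOn.comp hf.injOn h⟩

theorem IsEmb.isClopen_image [CompactSpace X] [T2Space X] (hf : IsEmb f U) :
    IsClopen (f '' U) := by
  have hc : ContinuousOn f U := fun x hx => (hf.isLocal x hx).continuousAt.continuousWithinAt
  refine ⟨(hf.isClopen.isClosed.isCompact.image_of_continuousOn hc).isClosed, ?_⟩
  rw [isOpen_iff_mem_nhds]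
  rintro _ ⟨x, hx, rfl⟩
  rw [← (hf.isLocal x hx).map_nhds_eq]
  exact image_mem_map (hf.isClopen.isOpen.mem_nhds hx)

theorem IsEmb.exists_symm [CompactSpace X] [T2Space X] (hf : IsEmb f U) :
    ∃ g : X → X, IsEmb g (f '' U) ∧ ∀ x ∈ U, g (f x) = x := by
  rcases U.eq_empty_or_nonempty with rfl | ⟨x₀, hx₀⟩
  · exact ⟨f, ⟨by simp [isClopen_empty], by simp, by simp⟩, by simp⟩
  have : Nonempty X := ⟨x₀⟩
  have hinv : ∀ x ∈ U, Function.invFunOn f U (f x) = x := fun x hx => hf.injOn.leftInvOn_invFunOn hx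
  refine ⟨Function.invFunOn f U, ⟨hf.isClopen_image, ?_, ?_⟩, hinv⟩
  · rintro _ ⟨x, hx, rfl⟩
    refine (hf.isLocal x hx).symm ?_
    filter_upwards [hf.isClopen.isOpen.mem_nhds hx] with y hy using hinv y hy
  · rintro _ ⟨x, hx, rfl⟩ _ ⟨y, hy, rfl⟩ h
    rw [hinv x hx, hinv y hy] at h
    rw [h]

/-! ### Embeddings from minimality and pure infiniteness -/

theorem IsMinimal.exists_isLocal (hmin : IsMinimal X) (x : X) (hD : IsOpen D) (hne : D.Nonempty) :
    ∃ f : X → X, IsLocal f x ∧ f x ∈ D := by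
  obtain ⟨_, hy, γ, rfl, rfl⟩ := (hmin x).inter_open_nonempty D hD hne
  obtain ⟨e, hγ, he⟩ := (EtaleGroupoid.isLocalHomeomorph_source (X := X)) γ
  have hleft : e γ = γ.left := by rw [← he]
  have ht : (γ.left : X) ∈ e.target := hleft ▸ e.map_source hγ
  refine ⟨_, isLocal_of_openPartialHomeomorph e he ht, ?_⟩
  have : e.symm (γ.left : X) = γ := by rw [← hleft, e.left_inv hγ]
  simpa only [this] using hy

theorem IsCompactOpenBisection.exists_isEmb {B : Set (Arrow X)} (hB : IsCompactOpenBisection B)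
    (hK : IsClopen (sourceSet B)) :
    ∃ f : X → X, IsEmb f (sourceSet B) ∧ f '' sourceSet B = rangeSet B := by
  have hl : ∀ γ ∈ B, ∀ η ∈ B, γ.left = η.left → γ = η := fun γ hγ η hη h => by
    have := hB.source.injective (a₁ := ⟨γ, hγ⟩) (a₂ := ⟨η, hη⟩) h
    exact congrArg Subtype.val this
  have hr : ∀ γ ∈ B, ∀ η ∈ B, γ.right = η.right → γ = η := fun γ hγ η hη h => by
    have := hB.range.injective (a₁ := ⟨γ, hγ⟩) (a₂ := ⟨η, hη⟩) h
    exact congrArg Subtype.val this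
  have hex : ∀ x : X, ∃ γ : Arrow X, x ∈ sourceSet B → γ ∈ B ∧ γ.left = x := fun x => by
    by_cases hx : x ∈ sourceSet B
    · obtain ⟨γ, hγ, h⟩ := hx
      exact ⟨γ, fun _ => ⟨hγ, h⟩⟩
    · exact ⟨unit x, fun h => (hx h).elim⟩
  choose ρ hρ using hex
  refine ⟨fun x => (ρ x).right, ⟨hK, fun x hx => ?_, fun x hx y hy hxy => ?_⟩, ?_⟩
  · obtain ⟨e, hγ, he⟩ := (EtaleGroupoid.isLocalHomeomorph_source (X := X)) (ρ x)
    have hleft : e (ρ x) = x := by rw [← he]; exact (hρ x hx).2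
    have ht : x ∈ e.target := hleft ▸ e.map_source hγ
    have hsx : e.symm x = ρ x := by rw [← e.left_inv hγ, hleft]
    refine (isLocal_of_openPartialHomeomorph e he ht).congr ?_
    have h1 : ∀ᶠ y in 𝓝 x, e.symm y ∈ B :=
      (e.symm.continuousAt ht).preimage_mem_nhds (hB.isOpen.mem_nhds (hsx ▸ (hρ x hx).1))
    filter_upwards [e.open_target.mem_nhds ht, hK.isOpen.mem_nhds hx, h1] with y hyt hyK hyB
    have h2 : (e.symm y).left = y := (congrFun he (e.symm y)).trans (e.right_inv hyt)
    rw [hl _ hyB _ (hρ y hyK).1 (h2.trans (hρ y hyK).2.symm)]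
  · have := hr _ (hρ x hx).1 _ (hρ y hy).1 hxy
    rw [← (hρ x hx).2, this, (hρ y hy).2]
  · ext z
    constructor
    · rintro ⟨x, hx, rfl⟩
      exact ⟨_, (hρ x hx).1, rfl⟩
    · rintro ⟨γ, hγ, rfl⟩
      have hx : γ.left ∈ sourceSet B := ⟨γ, hγ, rfl⟩
      exact ⟨γ.left, hx, congrArg (fun γ : Arrow X => (γ.right : X))
        (hl _ (hρ _ hx).1 _ hγ (hρ _ hx).2)⟩

theorem IsPurelyInfinite.exists_isEmb [CompactSpace X] (hinf : IsPurelyInfinite X)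
    (hD : IsClopen D) : ∃ f g : X → X, IsEmb f D ∧ IsEmb g D ∧ Disjoint (f '' D) (g '' D) ∧
      f '' D ⊆ D ∧ g '' D ⊆ D := by
  obtain ⟨B, B', hB, hB', hs, hs', hd, hr, hr'⟩ := hinf D hD.isClosed.isCompact hD.isOpen
  obtain ⟨f, hf, hfr⟩ := hB.exists_isEmb (hs ▸ hD)
  obtain ⟨g, hg, hgr⟩ := hB'.exists_isEmb (hs' ▸ hD)
  rw [hs] at hf hfr
  rw [hs'] at hg hgr
  exact ⟨f, g, hf, hg, by rwa [hfr, hgr], hfr ▸ hr, hgr ▸ hr'⟩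

variable [CompactSpace X] [T2Space X]

theorem IsPurelyInfinite.exists_two (hinf : IsPurelyInfinite X) (hD : IsClopen D)
    (hne : D.Nonempty) : ∃ C C' : Set X, IsClopen C ∧ IsClopen C' ∧ C.Nonempty ∧ C'.Nonempty ∧
      C ⊆ D ∧ C' ⊆ D ∧ Disjoint C C' := by
  obtain ⟨f, g, hf, hg, hd, h1, h2⟩ := hinf.exists_isEmb hD
  exact ⟨_, _, hf.isClopen_image, hg.isClopen_image, hne.image f, hne.image g, h1, h2, hd⟩

/-- A nonempty clopen set contains a smaller one which misses a given point. -/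
theorem IsPurelyInfinite.exists_ssubset (hinf : IsPurelyInfinite X) (hD : IsClopen D)
    (hne : D.Nonempty) (z : X) :
    ∃ C : Set X, IsClopen C ∧ C.Nonempty ∧ C ⊆ D ∧ z ∉ C ∧ (D \ C).Nonempty := by
  obtain ⟨C, C', hC, hC', hn, hn', hs, hs', hd⟩ := hinf.exists_two hD hne
  by_cases hz : z ∈ C
  · exact ⟨C', hC', hn', hs', fun h => hd.le_bot ⟨hz, h⟩,
      hn.mono fun y hy => ⟨hs hy, fun h => hd.le_bot ⟨hy, h⟩⟩⟩
  · exact ⟨C, hC, hn, hs, hz, hn'.mono fun y hy => ⟨hs' hy, fun h => hd.le_bot ⟨h, hy⟩⟩⟩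

/-- The sets are the successive differences of a strictly decreasing sequence of nonempty clopen
sets. -/
theorem IsPurelyInfinite.exists_seq (hinf : IsPurelyInfinite X) (hD : IsClopen D)
    (hne : D.Nonempty) : ∃ C : ℕ → Set X, (∀ n, IsClopen (C n)) ∧ (∀ n, (C n).Nonempty) ∧
      (∀ n, C n ⊆ D) ∧ Pairwise fun i j => Disjoint (C i) (C j) := by
  have step : ∀ S : {S : Set X // IsClopen S ∧ S.Nonempty},
      ∃ T : {S : Set X // IsClopen S ∧ S.Nonempty}, T.1 ⊆ S.1 ∧ (S.1 \ T.1).Nonempty := by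
    rintro ⟨S, hS, hS'⟩
    obtain ⟨C, hC, hn, hs, -, hd⟩ := hinf.exists_ssubset hS hS' hS'.some
    exact ⟨⟨C, hC, hn⟩, hs, hd⟩
  choose T hT hT' using step
  let S : ℕ → {S : Set X // IsClopen S ∧ S.Nonempty} := fun n => T^[n] ⟨D, hD, hne⟩
  have hS : ∀ n, S (n + 1) = T (S n) := fun n => Function.iterate_succ_apply' _ _ _
  have hanti : Antitone fun n => (S n).1 := antitone_nat_of_succ_le fun n => by
    rw [hS]
    exact hT _
  refine ⟨fun n => (S n).1 \ (S (n + 1)).1, fun n => (S n).2.1.diff (S (n + 1)).2.1,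
    fun n => by have := hT' (S n); rwa [← hS] at this,
    fun n => Set.sdiff_subset.trans (hanti (Nat.zero_le n)), ?_⟩
  have hlt : ∀ i j, i < j → Disjoint ((S i).1 \ (S (i + 1)).1) ((S j).1 \ (S (j + 1)).1) :=
    fun i j hij => Set.disjoint_left.2 fun x hx hx' => hx.2 (hanti (Nat.succ_le_of_lt hij) hx'.1)
  intro i j hij
  rcases lt_or_gt_of_ne hij with h | h
  · exact hlt i j h
  · exact (hlt j i h).symm

/-- Every clopen set embeds into every nonempty clopen set. -/
theorem exists_isEmb_into [TotallyDisconnectedSpace X] (hinf : IsPurelyInfinite X)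
    (hmin : IsMinimal X) (hU : IsClopen U) (hD : IsClopen D) (hne : D.Nonempty) :
    ∃ f : X → X, IsEmb f U ∧ f '' U ⊆ D := by
  obtain ⟨W, hUW, f, hf, hfD⟩ : ∃ W : Set X, U ⊆ W ∧ ∃ f : X → X, IsEmb f W ∧ f '' W ⊆ D := by
    refine hU.isClosed.isCompact.induction_on
      (p := fun S => ∃ W : Set X, S ⊆ W ∧ ∃ f : X → X, IsEmb f W ∧ f '' W ⊆ D)
      ⟨∅, subset_rfl, id, ⟨isClopen_empty, by simp, by simp⟩, by simp⟩
      (fun S T hST ⟨W, h1, h2⟩ => ⟨W, hST.trans h1, h2⟩) ?_ ?_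
    · rintro S T ⟨W, hSW, f, hf, hfD⟩ ⟨W', hTW, f', hf', hfD'⟩
      -- Two disjoint copies of `D` inside `D` leave room for both pieces: `W` goes into one copy
      -- and `W' \ W` into the other.
      obtain ⟨k, k', hk, hk', hd, h1, h2⟩ := hinf.exists_isEmb hD
      have hf'' := hf'.mono (hf'.isClopen.diff hf.isClopen) Set.sdiff_subset
      have m1 : f '' W ⊆ D := hfD
      have m2 : f' '' (W' \ W) ⊆ D := (Set.image_mono Set.sdiff_subset).trans hfD'
      classical
      have e1 : (k ∘ f) '' W ⊆ k '' D := by rw [Set.image_comp]; exact Set.image_mono m1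
      have e2 : (k' ∘ f') '' (W' \ W) ⊆ k' '' D := by
        rw [Set.image_comp]; exact Set.image_mono m2
      have := (hk.comp hf (Set.mapsTo_iff_image_subset.2 m1)).piecewise
        (hk'.comp hf'' (Set.mapsTo_iff_image_subset.2 m2)) Set.disjoint_sdiff_right (hd.mono e1 e2)
      refine ⟨_, ?_, _, this, ?_⟩
      · rw [Set.union_sdiff_self]
        exact Set.union_subset_union hSW hTW
      · rintro _ ⟨x, hx, rfl⟩
        by_cases hxW : x ∈ W
        · rw [Set.piecewise_eq_of_mem _ _ _ hxW]
          exact h1 (e1 ⟨x, hxW, rfl⟩)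
        · rw [Set.piecewise_eq_of_notMem _ _ _ hxW]
          exact h2 (e2 ⟨x, hx.resolve_left hxW, rfl⟩)
    · intro x _
      -- By minimality some arrow leads from `x` into `D`; its germ embeds a small clopen
      -- neighbourhood of `x`.
      obtain ⟨f, hf, hfx⟩ := hmin.exists_isLocal x hD.isOpen hne
      obtain ⟨W, hW, hinj⟩ := hf.exists_injOn
      have hev : {y | IsLocal f y ∧ y ∈ W ∧ f y ∈ D} ∈ 𝓝 x := by
        filter_upwards [hf.eventually, hW, hf.continuousAt.preimage_mem_nhds
          (hD.isOpen.mem_nhds hfx)] with y h1 h2 h3 using ⟨h1, h2, h3⟩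
      obtain ⟨O, hO, hOo, hxO⟩ := mem_nhds_iff.1 hev
      obtain ⟨C, hC, hxC, hCO⟩ := compact_exists_isClopen_in_isOpen hOo hxO
      refine ⟨C, mem_nhdsWithin_of_mem_nhds (hC.isOpen.mem_nhds hxC), C, subset_rfl, f,
        ⟨hC, fun y hy => (hO (hCO hy)).1, hinj.mono fun y hy => (hO (hCO hy)).2.1⟩, ?_⟩
      rintro _ ⟨y, hy, rfl⟩
      exact (hO (hCO hy)).2.2
  exact ⟨f, hf.mono hU hUW, (Set.image_mono hUW).trans hfD⟩

end Germs

end TopGroupoid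

namespace TopGroupoid

open Filter

/-! ### Three-cycles of homeomorphisms -/

section Cycles

variable {X : Type u} [TopologicalSpace X]

/-- `c` permutes cyclically the three sets `f i '' K`, and is the identity elsewhere. -/
structure IsCycle (K : Set X) (f : Fin 3 → X → X) (c : X ≃ₜ X) : Prop where
  apply : ∀ i, ∀ x ∈ K, c (f i x) = f (i + 1) x
  apply_of_notMem : ∀ y, (∀ i, y ∉ f i '' K) → c y = y

variable {K K' : Set X} {f f' : Fin 3 → X → X} {c c' a b : X ≃ₜ X}

theorem IsCycle.unique (hc : IsCycle K f c) (hc' : IsCycle K f c') : c = c' := by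
  ext y
  by_cases hy : ∃ i, y ∈ f i '' K
  · obtain ⟨i, x, hx, rfl⟩ := hy
    rw [hc.apply i x hx, hc'.apply i x hx]
  · push Not at hy
    rw [hc.apply_of_notMem y hy, hc'.apply_of_notMem y hy]

theorem IsCycle.congr (hc : IsCycle K f c) (h : ∀ i, Set.EqOn (f i) (f' i) K) :
    IsCycle K f' c where
  apply i x hx := by rw [← h i hx, ← h (i + 1) hx, hc.apply i x hx]
  apply_of_notMem y hy := hc.apply_of_notMem y fun i => by rw [(h i).image_eq]; exact hy i

theorem IsCycle.conj (hc : IsCycle K f c) (a : X ≃ₜ X) :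
    IsCycle K (fun i => a ∘ f i) (a * c * a⁻¹) where
  apply i x hx := by simp [hc.apply i x hx]
  apply_of_notMem y hy := by
    have : c (a.symm y) = a.symm y := hc.apply_of_notMem _ fun i ⟨x, hx, h⟩ =>
      hy i ⟨x, hx, by simp [h]⟩
    simp [this]

theorem IsCycle.symm_apply (hc : IsCycle K f c) (i : Fin 3) {x : X} (hx : x ∈ K) :
    c.symm (f (i + 1) x) = f i x := by
  rw [← hc.apply i x hx, Homeomorph.symm_apply_apply]

theorem IsCycle.symm_apply_of_notMem (hc : IsCycle K f c) {y : X} (hy : ∀ i, y ∉ f i '' K) :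
    c.symm y = y := by
  conv_lhs => rw [← hc.apply_of_notMem y hy, Homeomorph.symm_apply_apply]

theorem IsCycle.inv (hc : IsCycle K f c) : IsCycle K ![f 1, f 0, f 2] c⁻¹ where
  apply i x hx := by
    fin_cases i
    · exact hc.symm_apply 0 hx
    · exact hc.symm_apply 2 hx
    · exact hc.symm_apply 1 hx
  apply_of_notMem y hy := hc.symm_apply_of_notMem fun i => by
    fin_cases i
    exacts [hy 1, hy 0, hy 2]

theorem IsCycle.pow_three (hc : IsCycle K f c) : c ^ 3 = 1 := by
  ext y
  by_cases hy : ∃ i, y ∈ f i '' K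
  · obtain ⟨i, x, hx, rfl⟩ := hy
    simp only [pow_succ, pow_zero, one_mul, Homeomorph.mul_apply, Homeomorph.one_apply,
      hc.apply _ x hx, add_assoc]
    rw [show i + (1 + (1 + 1)) = i by revert i; decide]
  · push Not at hy
    simp only [pow_succ, pow_zero, one_mul, Homeomorph.mul_apply, Homeomorph.one_apply,
      hc.apply_of_notMem y hy]

theorem IsCycle.mul (hc : IsCycle K f c) (hc' : IsCycle K' f c')
    (h : ∀ i j, Disjoint (f i '' K) (f j '' K')) : IsCycle (K ∪ K') f (c * c') where
  apply i x hx := by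
    by_cases hxK : x ∈ K'
    · rw [Homeomorph.mul_apply, hc'.apply i x hxK]
      exact hc.apply_of_notMem _ fun j hj => (h j (i + 1)).le_bot ⟨hj, x, hxK, rfl⟩
    · have hx' := hx.resolve_right hxK
      rw [Homeomorph.mul_apply, hc'.apply_of_notMem _ fun j hj => (h i j).le_bot
        ⟨⟨x, hx', rfl⟩, hj⟩, hc.apply i x hx']
  apply_of_notMem y hy := by
    rw [Homeomorph.mul_apply, hc'.apply_of_notMem y fun i hi => hy i
      (Set.image_mono Set.subset_union_right hi), hc.apply_of_notMem y fun i hi => hy i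
      (Set.image_mono Set.subset_union_left hi)]

theorem mul_comm_of_disjoint {S T : Set X} (hST : Disjoint S T) (ha : ∀ x, x ∉ S → a x = x)
    (hb : ∀ x, x ∉ T → b x = x) : a * b = b * a := by
  have mem : ∀ (c : X ≃ₜ X) (S : Set X), (∀ x, x ∉ S → c x = x) → ∀ x ∈ S, c x ∈ S := by
    intro c S hc x hx
    by_contra h
    have h' := c.injective (hc _ h)
    rw [h'] at h
    exact h hx
  ext x
  simp only [Homeomorph.mul_apply]
  by_cases hxS : x ∈ S
  · rw [hb x fun h => hST.le_bot ⟨hxS, h⟩, hb (a x) fun h => hST.le_bot ⟨mem a S ha x hxS, h⟩]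
  · rw [ha x hxS]
    by_cases hxT : x ∈ T
    · exact ha _ fun h => hST.le_bot ⟨h, mem b T hb x hxT⟩
    · rw [hb x hxT, ha x hxS]

/-- The commutator of two three-cycles with one common set is a three-cycle. -/
theorem IsCycle.commutator {k : Fin 5 → X → X}
    (hk : Pairwise fun i j => Disjoint (k i '' K) (k j '' K))
    (hc : IsCycle K ![k 0, k 1, k 2] c) (hc' : IsCycle K ![k 2, k 3, k 4] c') :
    IsCycle K ![k 0, k 3, k 2] (c * c' * c⁻¹ * c'⁻¹) := by
  have hne : ∀ i j, i ≠ j → ∀ x ∈ K, k i x ∉ k j '' K := fun i j hij x hx h =>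
    (hk hij).le_bot ⟨⟨x, hx, rfl⟩, h⟩
  have c0 : ∀ x ∈ K, c (k 0 x) = k 1 x := hc.apply 0
  have c1 : ∀ x ∈ K, c (k 1 x) = k 2 x := hc.apply 1
  have c2 : ∀ x ∈ K, c (k 2 x) = k 0 x := hc.apply 2
  have s0 : ∀ x ∈ K, c.symm (k 0 x) = k 2 x := fun x hx => hc.symm_apply 2 hx
  have s1 : ∀ x ∈ K, c.symm (k 1 x) = k 0 x := fun x hx => hc.symm_apply 0 hx
  have s2 : ∀ x ∈ K, c.symm (k 2 x) = k 1 x := fun x hx => hc.symm_apply 1 hx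
  have d2 : ∀ x ∈ K, c' (k 2 x) = k 3 x := hc'.apply 0
  have d3 : ∀ x ∈ K, c' (k 3 x) = k 4 x := hc'.apply 1
  have d4 : ∀ x ∈ K, c' (k 4 x) = k 2 x := hc'.apply 2
  have t2 : ∀ x ∈ K, c'.symm (k 2 x) = k 4 x := fun x hx => hc'.symm_apply 2 hx
  have t3 : ∀ x ∈ K, c'.symm (k 3 x) = k 2 x := fun x hx => hc'.symm_apply 0 hx
  have t4 : ∀ x ∈ K, c'.symm (k 4 x) = k 3 x := fun x hx => hc'.symm_apply 1 hx
  have cn : ∀ y, y ∉ k 0 '' K → y ∉ k 1 '' K → y ∉ k 2 '' K → ∀ i : Fin 3,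
      y ∉ (![k 0, k 1, k 2] : Fin 3 → X → X) i '' K := by
    intro y h0 h1 h2 i
    fin_cases i
    exacts [h0, h1, h2]
  have dn : ∀ y, y ∉ k 2 '' K → y ∉ k 3 '' K → y ∉ k 4 '' K → ∀ i : Fin 3,
      y ∉ (![k 2, k 3, k 4] : Fin 3 → X → X) i '' K := by
    intro y h0 h1 h2 i
    fin_cases i
    exacts [h0, h1, h2]
  have cfix : ∀ y, y ∉ k 0 '' K → y ∉ k 1 '' K → y ∉ k 2 '' K → c y = y ∧ c.symm y = y :=
    fun y h0 h1 h2 => ⟨hc.apply_of_notMem y (cn y h0 h1 h2),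
      hc.symm_apply_of_notMem (cn y h0 h1 h2)⟩
  have dfix : ∀ y, y ∉ k 2 '' K → y ∉ k 3 '' K → y ∉ k 4 '' K → c' y = y ∧ c'.symm y = y :=
    fun y h0 h1 h2 => ⟨hc'.apply_of_notMem y (dn y h0 h1 h2),
      hc'.symm_apply_of_notMem (dn y h0 h1 h2)⟩
  have c3 := fun x hx => cfix (k 3 x) (hne 3 0 (by decide) x hx) (hne 3 1 (by decide) x hx)
    (hne 3 2 (by decide) x hx)
  have c4 := fun x hx => cfix (k 4 x) (hne 4 0 (by decide) x hx) (hne 4 1 (by decide) x hx)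
    (hne 4 2 (by decide) x hx)
  have d0 := fun x hx => dfix (k 0 x) (hne 0 2 (by decide) x hx) (hne 0 3 (by decide) x hx)
    (hne 0 4 (by decide) x hx)
  have d1 := fun x hx => dfix (k 1 x) (hne 1 2 (by decide) x hx) (hne 1 3 (by decide) x hx)
    (hne 1 4 (by decide) x hx)
  refine ⟨fun i x hx => ?_, fun y hy => ?_⟩
  · fin_cases i
    · change c (c' (c.symm (c'.symm (k 0 x)))) = k 3 x
      rw [(d0 x hx).2, s0 x hx, d2 x hx, (c3 x hx).1]
    · change c (c' (c.symm (c'.symm (k 3 x)))) = k 2 x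
      rw [t3 x hx, s2 x hx, (d1 x hx).1, c1 x hx]
    · change c (c' (c.symm (c'.symm (k 2 x)))) = k 0 x
      rw [t2 x hx, (c4 x hx).2, d4 x hx, c2 x hx]
  · change c (c' (c.symm (c'.symm y))) = y
    have y0 : y ∉ k 0 '' K := hy 0
    have y3 : y ∉ k 3 '' K := hy 1
    have y2 : y ∉ k 2 '' K := hy 2
    by_cases y1 : y ∈ k 1 '' K
    · obtain ⟨x, hx, rfl⟩ := y1
      rw [(d1 x hx).2, s1 x hx, (d0 x hx).1, c0 x hx]
    by_cases y4 : y ∈ k 4 '' K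
    · obtain ⟨x, hx, rfl⟩ := y4
      rw [t4 x hx, (c3 x hx).2, d3 x hx, (c4 x hx).1]
    rw [(dfix y y2 y3 y4).2, (cfix y y0 y1 y2).2, (dfix y y2 y3 y4).1, (cfix y y0 y1 y2).1]

end Cycles

/-! ### Extending embeddings to the alternating group -/

section Transport

variable {X : Type u} [TopologicalSpace X] [Groupoid.{v} X] [TopologicalSpace (Arrow X)]
  [EtaleGroupoid X] [CompactSpace X] [T2Space X]

/-- Two families of embeddings with disjoint images are intertwined by one embedding. -/
theorem exists_transport {ι : Type*} [Finite ι] {K : ι → Set X} {f f' : ι → X → X}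
    (hf : ∀ i, IsEmb (f i) (K i)) (hf' : ∀ i, IsEmb (f' i) (K i))
    (hd : Pairwise fun i j => Disjoint (f i '' K i) (f j '' K j))
    (hd' : Pairwise fun i j => Disjoint (f' i '' K i) (f' j '' K j)) :
    ∃ φ : X → X, IsEmb φ (⋃ i, f i '' K i) ∧ (∀ i, ∀ x ∈ K i, φ (f i x) = f' i x) ∧
      ∀ y, y ∉ ⋃ i, f i '' K i → φ y = y := by
  classical
  let φ : X → X := fun y =>
    if h : ∃ p : ι × X, p.2 ∈ K p.1 ∧ f p.1 p.2 = y then f' h.choose.1 h.choose.2 else y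
  have h1 : ∀ i, ∀ x ∈ K i, φ (f i x) = f' i x := by
    intro i x hx
    have h : ∃ p : ι × X, p.2 ∈ K p.1 ∧ f p.1 p.2 = f i x := ⟨(i, x), hx, rfl⟩
    have hφ : φ (f i x) = f' h.choose.1 h.choose.2 := dif_pos h
    obtain ⟨k1, k2⟩ := h.choose_spec
    generalize h.choose = p at hφ k1 k2
    obtain ⟨j, z⟩ := p
    have hij : j = i := by
      by_contra hne
      exact (hd hne).le_bot ⟨⟨z, k1, k2⟩, ⟨x, hx, rfl⟩⟩
    subst hij
    rw [hφ, (hf j).injOn k1 hx k2]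
  have h2 : ∀ y, y ∉ ⋃ i, f i '' K i → φ y = y := fun y hy =>
    dif_neg fun ⟨p, hp, hpy⟩ => hy (Set.mem_iUnion.2 ⟨p.1, p.2, hp, hpy⟩)
  refine ⟨φ, ⟨isClopen_iUnion_of_finite fun i => (hf i).isClopen_image, ?_, ?_⟩, h1, h2⟩
  · intro y hy
    obtain ⟨i, x, hx, rfl⟩ := Set.mem_iUnion.1 hy
    obtain ⟨g, hg, hgf⟩ := (hf i).exists_symm
    have hx' : f i x ∈ f i '' K i := ⟨x, hx, rfl⟩
    have hloc : IsLocal (f' i ∘ g) (f i x) :=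
      IsLocal.comp ((hgf x hx).symm ▸ (hf' i).isLocal x hx) (hg.isLocal _ hx')
    refine hloc.congr ?_
    filter_upwards [(hf i).isClopen_image.isOpen.mem_nhds hx'] with z hz
    obtain ⟨w, hw, rfl⟩ := hz
    rw [h1 i w hw, Function.comp_apply, hgf w hw]
  · intro y hy z hz hyz
    obtain ⟨i, x, hx, rfl⟩ := Set.mem_iUnion.1 hy
    obtain ⟨j, w, hw, rfl⟩ := Set.mem_iUnion.1 hz
    rw [h1 i x hx, h1 j w hw] at hyz
    have hij : i = j := by
      by_contra hne
      exact (hd' hne).le_bot ⟨⟨x, hx, rfl⟩, ⟨w, hw, hyz.symm⟩⟩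
    subst hij
    rw [(hf' i).injOn hx hw hyz]

theorem IsCycle.mem_alternatingGroup {K : Set X} {f : Fin 3 → X → X} {c : X ≃ₜ X}
    (hc : IsCycle K f c) (hF : c ∈ fullGroup X) (hf : ∀ i, IsEmb (f i) K)
    (hd : Pairwise fun i j => Disjoint (f i '' K) (f j '' K)) : c ∈ alternatingGroup X := by
  rcases K.eq_empty_or_nonempty with rfl | ⟨x, hx⟩
  · have : c = 1 := by
      ext y
      exact hc.apply_of_notMem y (by simp)
    rw [this]
    exact one_mem _
  refine Subgroup.subset_closure ⟨hF, ?_, fun i => f i '' K, fun i =>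
    ⟨(hf i).isClopen_image.isClosed.isCompact, (hf i).isClopen_image.isOpen⟩, hd, fun i => ?_,
    fun y hy => hc.apply_of_notMem y fun i hi => hy (Set.mem_iUnion.2 ⟨i, hi⟩)⟩
  · have : Fact (Nat.Prime 3) := ⟨Nat.prime_three⟩
    refine orderOf_eq_prime hc.pow_three fun h => ?_
    have h1 := hc.apply 0 x hx
    rw [h] at h1
    exact (hd (show (0 : Fin 3) ≠ 1 by decide)).le_bot ⟨⟨x, hx, rfl⟩, ⟨x, hx, h1.symm⟩⟩
  · rw [Set.image_image]
    exact Set.image_congr (hc.apply i)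

variable [TotallyDisconnectedSpace X]

/-- Transporting the family to its cyclic shift gives a map with cube the identity, so its own
square is a continuous inverse. -/
theorem exists_isCycle {K : Set X} {f : Fin 3 → X → X} (hf : ∀ i, IsEmb (f i) K)
    (hd : Pairwise fun i j => Disjoint (f i '' K) (f j '' K)) :
    ∃ c ∈ alternatingGroup X, IsCycle K f c := by
  obtain ⟨φ, hφ, h1, h2⟩ := exists_transport hf (fun i => hf (i + 1)) hd
    (fun i j hij => hd fun h => hij (add_right_cancel h))
  have hfin : ∀ i : Fin 3, i + 1 + 1 + 1 = i := by decide
  have h3 : ∀ y, φ (φ (φ y)) = y := by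
    intro y
    by_cases hy : y ∈ ⋃ i, f i '' K
    · obtain ⟨i, x, hx, rfl⟩ := Set.mem_iUnion.1 hy
      rw [h1 i x hx, h1 _ x hx, h1 _ x hx, hfin]
    · rw [h2 y hy, h2 y hy, h2 y hy]
  have hloc : ∀ y, IsLocal φ y := by
    intro y
    by_cases hy : y ∈ ⋃ i, f i '' K
    · exact hφ.isLocal y hy
    · refine (isLocal_id y).congr ?_
      filter_upwards [hφ.isClopen.compl.isOpen.mem_nhds hy] with z hz using (h2 z hz).symm
  have hcont : Continuous φ := continuous_iff_continuousAt.2 fun y => (hloc y).continuousAt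
  let c : X ≃ₜ X := ⟨⟨φ, φ ∘ φ, h3, h3⟩, hcont, hcont.comp hcont⟩
  have hc : IsCycle K f c := ⟨h1, fun y hy => h2 y (by simpa using hy)⟩
  exact ⟨c, hc.mem_alternatingGroup (mem_fullGroup_of_isLocal hloc) hf hd, hc⟩

/-- Place a third copy of `U` in the free space and rotate the three copies. -/
theorem exists_extension_of_disjoint (hinf : IsPurelyInfinite X) (hmin : IsMinimal X)
    {U : Set X} {φ : X → X} (hφ : IsEmb φ U)
    (hd : Disjoint U (φ '' U)) (hu : U ∪ φ '' U ≠ Set.univ) :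
    ∃ a ∈ alternatingGroup X, ∀ x ∈ U, a x = φ x := by
  obtain ⟨k, hk, hkU⟩ := exists_isEmb_into hinf hmin hφ.isClopen
    (hφ.isClopen.union hφ.isClopen_image).compl (Set.nonempty_compl.2 hu)
  have hid : IsEmb id U := ⟨hφ.isClopen, fun x _ => isLocal_id x, Function.injective_id.injOn⟩
  have h1 : Disjoint (φ '' U) (k '' U) :=
    Set.disjoint_left.2 fun x hx hx' => hkU hx' (Or.inr hx)
  have h2 : Disjoint U (k '' U) := Set.disjoint_left.2 fun x hx hx' => hkU hx' (Or.inl hx)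
  obtain ⟨c, hc, hcyc⟩ := exists_isCycle (K := U) (f := ![id, φ, k])
    (fun i => by fin_cases i; exacts [hid, hφ, hk]) (fun i j hij => by
      fin_cases i <;> fin_cases j <;>
        simp_all [h1.symm, h2.symm, hd.symm])
  exact ⟨c, hc, fun x hx => hcyc.apply 0 x hx⟩

/-- Every embedding between proper clopen sets extends to an element of the alternating group. -/
theorem exists_extension (hinf : IsPurelyInfinite X) (hmin : IsMinimal X)
    {U : Set X} {φ : X → X} (hφ : IsEmb φ U) (hU : U ≠ Set.univ)
    (hφU : φ '' U ≠ Set.univ) : ∃ a ∈ alternatingGroup X, ∀ x ∈ U, a x = φ x := by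
  -- The map is factored as `U → k '' U → k' '' U → φ '' U`, consecutive sets being disjoint with
  -- proper union. The point `z` outside `φ '' U` is kept out of `k '' U`, so that free space
  -- remains for `k'`.
  obtain ⟨z, hz⟩ := Set.nonempty_compl.2 hφU
  obtain ⟨C, hC, hCne, hCU, hzC, y, hyU, hyC⟩ :=
    hinf.exists_ssubset hφ.isClopen.compl (Set.nonempty_compl.2 hU) z
  obtain ⟨k, hk, hkC⟩ := exists_isEmb_into hinf hmin hφ.isClopen hC hCne
  obtain ⟨g, hg, hgk⟩ := hk.exists_symm
  have hgm : Set.MapsTo g (k '' U) U := by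
    rintro _ ⟨x, hx, rfl⟩
    rwa [hgk x hx]
  obtain ⟨a, ha, hak⟩ := exists_extension_of_disjoint hinf hmin hk
    (Set.disjoint_left.2 fun x hx hx' => hCU (hkC hx') hx)
    (fun h => (h ▸ Set.mem_univ y : y ∈ U ∪ k '' U).elim hyU fun h => hyC (hkC h))
  have hzu : z ∉ k '' U ∪ φ '' U := fun h => h.elim (fun h => hzC (hkC h)) hz
  obtain ⟨C', hC', hCne', hCU', -, w, hw, hwC⟩ :=
    hinf.exists_ssubset (hk.isClopen_image.union hφ.isClopen_image).compl ⟨z, hzu⟩ z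
  obtain ⟨k', hk', hkC'⟩ := exists_isEmb_into hinf hmin hφ.isClopen hC' hCne'
  obtain ⟨g', hg', hgk'⟩ := hk'.exists_symm
  have hgm' : Set.MapsTo g' (k' '' U) U := by
    rintro _ ⟨x, hx, rfl⟩
    rwa [hgk' x hx]
  have e1 : (k' ∘ g) '' (k '' U) = k' '' U := by
    rw [Set.image_image]
    exact Set.image_congr fun x hx => by rw [Function.comp_apply, hgk x hx]
  have e2 : (φ ∘ g') '' (k' '' U) = φ '' U := by
    rw [Set.image_image]
    exact Set.image_congr fun x hx => by rw [Function.comp_apply, hgk' x hx]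
  obtain ⟨b, hb, hbk⟩ := exists_extension_of_disjoint hinf hmin (hk'.comp hg hgm)
    (by rw [e1]; exact Set.disjoint_left.2 fun x hx hx' => hCU' (hkC' hx') (Or.inl hx))
    (by
      rw [e1]
      exact fun h => (h ▸ Set.mem_univ w : w ∈ k '' U ∪ k' '' U).elim (fun h => hw (Or.inl h))
        fun h => hwC (hkC' h))
  obtain ⟨c, hc, hck⟩ := exists_extension_of_disjoint hinf hmin (hφ.comp hg' hgm')
    (by rw [e2]; exact Set.disjoint_left.2 fun x hx hx' => hCU' (hkC' hx) (Or.inr hx'))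
    (by
      rw [e2]
      exact fun h => (h ▸ Set.mem_univ w : w ∈ k' '' U ∪ φ '' U).elim (fun h => hwC (hkC' h))
        fun h => hw (Or.inr h))
  refine ⟨c * b * a, mul_mem (mul_mem hc hb) ha, fun x hx => ?_⟩
  rw [Homeomorph.mul_apply, Homeomorph.mul_apply, hak x hx, hbk _ ⟨x, hx, rfl⟩,
    Function.comp_apply, hgk x hx, hck _ ⟨x, hx, rfl⟩, Function.comp_apply, hgk' x hx]

/-- Two families of embeddings with disjoint images which do not cover the space are conjugate
under the alternating group. -/
theorem exists_intertwining (hinf : IsPurelyInfinite X) (hmin : IsMinimal X)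
    {ι : Type*} [Finite ι] {K : ι → Set X} {f f' : ι → X → X}
    (hf : ∀ i, IsEmb (f i) (K i)) (hf' : ∀ i, IsEmb (f' i) (K i))
    (hd : Pairwise fun i j => Disjoint (f i '' K i) (f j '' K j))
    (hd' : Pairwise fun i j => Disjoint (f' i '' K i) (f' j '' K j))
    (hu : (⋃ i, f i '' K i) ≠ Set.univ) (hu' : (⋃ i, f' i '' K i) ≠ Set.univ) :
    ∃ a ∈ alternatingGroup X, ∀ i, ∀ x ∈ K i, a (f i x) = f' i x := by
  obtain ⟨φ, hφ, h1, -⟩ := exists_transport hf hf' hd hd'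
  have himg : φ '' (⋃ i, f i '' K i) = ⋃ i, f' i '' K i := by
    rw [Set.image_iUnion]
    refine Set.iUnion_congr fun i => ?_
    rw [Set.image_image]
    exact Set.image_congr (h1 i)
  obtain ⟨a, ha, haφ⟩ := exists_extension hinf hmin hφ hu (himg ▸ hu')
  exact ⟨a, ha, fun i x hx => by
    rw [haφ _ (Set.mem_iUnion.2 ⟨i, x, hx, rfl⟩), h1 i x hx]⟩

end Transport

end TopGroupoid

namespace TopGroupoid

open Filter
open scoped Pointwise

instance homeomorphMulAction (X : Type u) [TopologicalSpace X] : MulAction (X ≃ₜ X) X where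
  smul φ x := φ x
  one_smul _ := rfl
  mul_smul _ _ _ := rfl

/-! ### Simplicity, and the shiftable three-cycle -/

section Simplicity

variable {X : Type u} [TopologicalSpace X] [Groupoid.{v} X] [TopologicalSpace (Arrow X)]
  [EtaleGroupoid X] [CompactSpace X]

theorem isEmb_of_mem_alternatingGroup {a : X ≃ₜ X} (ha : a ∈ alternatingGroup X) {V : Set X}
    (hV : IsClopen V) : IsEmb a V :=
  ⟨hV, fun x _ => isLocal_of_mem_fullGroup (alternatingGroup_le_fullGroup X ha) x,
    a.injective.injOn⟩

variable [T2Space X] [TotallyDisconnectedSpace X]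

/-- A small clopen neighbourhood of a moved point is displaced. Shrinking it further leaves a point
of the old neighbourhood in neither the new set nor its image. -/
theorem IsPurelyInfinite.exists_displaced (hinf : IsPurelyInfinite X) {g : X ≃ₜ X} (hg : g ≠ 1) :
    ∃ D : Set X, IsClopen D ∧ D.Nonempty ∧ Disjoint D (g '' D) ∧ D ∪ g '' D ≠ Set.univ := by
  obtain ⟨x, hx⟩ : ∃ x, g x ≠ x := by
    by_contra h
    push Not at h
    exact hg (Homeomorph.ext h)
  obtain ⟨O, O', hO, hO', hxO, hxO', hd⟩ := t2_separation hx.symm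
  obtain ⟨D, hD, hxD, hDO⟩ := compact_exists_isClopen_in_isOpen
    (hO.inter (hO'.preimage g.continuous)) (show x ∈ O ∩ g ⁻¹' O' from ⟨hxO, hxO'⟩)
  have hDD : Disjoint D (g '' D) := by
    refine Set.disjoint_left.2 ?_
    rintro _ hy ⟨z, hz, rfl⟩
    exact hd.le_bot ⟨(hDO hy).1, (hDO hz).2⟩
  obtain ⟨C, hC, hCne, hCD, -, y, hy, hyC⟩ := hinf.exists_ssubset hD ⟨x, hxD⟩ x
  refine ⟨C, hC, hCne, hDD.mono hCD (Set.image_mono hCD), fun h => ?_⟩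
  exact (h ▸ Set.mem_univ y : y ∈ C ∪ g '' C).elim hyC fun h =>
    hDD.le_bot ⟨hy, Set.image_mono hCD h⟩

/-- A subgroup normalised by the alternating group which contains all three-cycles with proper
support contains the alternating group. -/
theorem alternatingGroup_le_of_isCycle (hinf : IsPurelyInfinite X) {N : Subgroup (X ≃ₜ X)}
    (hN : ∀ (K : Set X) (f : Fin 3 → X → X) (c : X ≃ₜ X), (∀ i, IsEmb (f i) K) →
      (Pairwise fun i j => Disjoint (f i '' K) (f j '' K)) → (⋃ i, f i '' K) ≠ Set.univ →
      IsCycle K f c → c ∈ N) : alternatingGroup X ≤ N := by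
  refine (Subgroup.closure_le _).2 ?_
  rintro g ⟨hg, hg3, Y, hY, hYd, hgY, hgfix⟩
  have hYcl : ∀ j, IsClopen (Y j) := fun j => ⟨(hY j).1.isClosed, (hY j).2⟩
  have h3 : ∀ x, g (g (g x)) = x := fun x => by
    have h := pow_orderOf_eq_one g
    rw [hg3] at h
    exact DFunLike.congr_fun h x
  let f : Fin 3 → X → X := ![id, g, g ∘ g]
  have himg : ∀ i, f i '' Y 0 = Y i := fun i => by
    fin_cases i
    · exact Set.image_id _
    · exact hgY 0
    · change (g ∘ g) '' Y 0 = Y 2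
      rw [Set.image_comp, hgY 0]
      exact hgY 1
  have hloc : IsEmb g Set.univ :=
    ⟨isClopen_univ, fun x _ => isLocal_of_mem_fullGroup hg x, g.injective.injOn⟩
  have hf : ∀ i, IsEmb (f i) Set.univ := fun i => by
    fin_cases i
    · exact ⟨isClopen_univ, fun x _ => isLocal_id x, Function.injective_id.injOn⟩
    · exact hloc
    · exact hloc.comp hloc (Set.mapsTo_univ _ _)
  have hd : ∀ i j, i ≠ j → Disjoint (f i '' Y 0) (f j '' Y 0) := fun i j hij => by
    rw [himg, himg]
    exact hYd hij
  have hcyc : IsCycle (Y 0) f g := by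
    refine ⟨fun i x _ => ?_, fun y hy => hgfix y (by simpa [himg] using hy)⟩
    fin_cases i
    exacts [rfl, rfl, h3 x]
  rcases (Y 0).eq_empty_or_nonempty with h0 | hne
  · have : g = 1 := by
      ext y
      exact hcyc.apply_of_notMem y (by simp [h0])
    rw [this]
    exact one_mem _
  -- The support of a generator may be all of `X`; splitting `Y 0` writes it as a product of two
  -- three-cycles, each with proper support.
  obtain ⟨C, hC, hCne, hCY, -, hdiff⟩ := hinf.exists_ssubset (hYcl 0) hne hne.some
  have hC' := (hYcl 0).diff hC
  have part : ∀ S T : Set X, IsClopen S → S ⊆ Y 0 → T ⊆ Y 0 → T.Nonempty → Disjoint S T →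
      ∃ c ∈ N, IsCycle S f c := by
    intro S T hS hSY hTY hT hST
    have hdS : Pairwise fun i j => Disjoint (f i '' S) (f j '' S) := fun i j hij =>
      (hd i j hij).mono (Set.image_mono hSY) (Set.image_mono hSY)
    have hfS : ∀ i, IsEmb (f i) S := fun i => (hf i).mono hS (Set.subset_univ _)
    obtain ⟨c, -, hc⟩ := exists_isCycle hfS hdS
    refine ⟨c, hN S f c hfS hdS (fun hu => ?_) hc, hc⟩
    obtain ⟨y, hy⟩ := hT
    obtain ⟨i, x, hx, hxy⟩ := Set.mem_iUnion.1 (hu ▸ Set.mem_univ y)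
    have hi : i = 0 := by
      by_contra h
      exact (hd i 0 h).le_bot ⟨⟨x, hSY hx, hxy⟩, ⟨y, hTY hy, rfl⟩⟩
    subst hi
    exact hST.le_bot ⟨hx, (show x = y from hxy) ▸ hy⟩
  obtain ⟨c, hcN, hc⟩ := part C (Y 0 \ C) hC hCY Set.sdiff_subset hdiff Set.disjoint_sdiff_right
  obtain ⟨c', hcN', hc'⟩ := part (Y 0 \ C) C hC' Set.sdiff_subset hCY hCne
    Set.disjoint_sdiff_left
  have hmul := hc.mul hc' fun i j => by
    by_cases hij : i = j
    · subst hij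
      refine Set.disjoint_left.2 ?_
      rintro _ ⟨x, hx, rfl⟩ ⟨y, hy, hxy⟩
      exact hy.2 ((hf i).injOn trivial trivial hxy ▸ hx)
    · exact (hd i j hij).mono (Set.image_mono hCY) (Set.image_mono Set.sdiff_subset)
  rw [Set.union_sdiff_self, Set.union_eq_self_of_subset_left hCY] at hmul
  rw [hcyc.unique hmul]
  exact mul_mem hcN hcN'

/-- A nontrivial subgroup of the alternating group normalised by it is the whole group. -/
theorem alternatingGroup_le_of_normal (hinf : IsPurelyInfinite X) (hmin : IsMinimal X)
    {N : Subgroup (X ≃ₜ X)}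
    (hconj : ∀ n ∈ N, ∀ a ∈ alternatingGroup X, a * n * a⁻¹ ∈ N) {h : X ≃ₜ X} (hh : h ∈ N)
    (hne : h ≠ 1) : alternatingGroup X ≤ N := by
  obtain ⟨D, hD, hDne, hDd, -⟩ := hinf.exists_displaced hne
  -- The commutator of `a` and `h` is `a * (h * a * h⁻¹)⁻¹`, and its second factor lives on `h ''
  -- D`, so commutes with `b`. Hence the double commutator with `b`, which lies in `N`, equals that
  -- of `a` and `b`.
  have hcomm : ∀ a ∈ alternatingGroup X, ∀ b ∈ alternatingGroup X, (∀ x, x ∉ D → a x = x) →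
      (∀ x, x ∉ D → b x = x) → a * b * a⁻¹ * b⁻¹ ∈ N := by
    intro a ha b hb haD hbD
    have h1 : a * h * a⁻¹ * h⁻¹ ∈ N := mul_mem (hconj h hh a ha) (inv_mem hh)
    have h2 : a * h * a⁻¹ * h⁻¹ * (b * (a * h * a⁻¹ * h⁻¹)⁻¹ * b⁻¹) ∈ N :=
      mul_mem h1 (hconj _ (inv_mem h1) b hb)
    have h3 : b * (h * a * h⁻¹) = h * a * h⁻¹ * b := by
      refine mul_comm_of_disjoint hDd hbD fun x hx => ?_
      have : a (h.symm x) = h.symm x := haD _ fun hx' => hx ⟨_, hx', by simp⟩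
      simp [this]
    have h4 : a * h * a⁻¹ * h⁻¹ * (b * (a * h * a⁻¹ * h⁻¹)⁻¹ * b⁻¹) =
        a * (h * a * h⁻¹)⁻¹ * (b * (h * a * h⁻¹)) * a⁻¹ * b⁻¹ := by group
    rw [h4, h3] at h2
    convert h2 using 1
    group
  refine alternatingGroup_le_of_isCycle hinf fun K f c hf hd hu hc => ?_
  -- Five copies of `K` inside `D` carry two three-cycles sharing one copy. Their commutator is a
  -- three-cycle in `N`, and it is conjugate to `c`. The sixth set `C 5` stays free, so that the
  -- conjugating element exists.
  obtain ⟨C, hC, hCne, hCD, hCd⟩ := hinf.exists_seq hD hDne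
  have hex : ∀ i : Fin 5, ∃ k : X → X, IsEmb k K ∧ k '' K ⊆ C i := fun i =>
    exists_isEmb_into hinf hmin (hf 0).isClopen (hC i) (hCne i)
  choose k hk hkC using hex
  have hkd : ∀ i j : Fin 5, i ≠ j → Disjoint (k i '' K) (k j '' K) := fun i j hij =>
    (hCd fun h => hij (Fin.ext h)).mono (hkC i) (hkC j)
  have hkD : ∀ i, k i '' K ⊆ D := fun i => (hkC i).trans (hCD i)
  have cyc : ∀ i j l : Fin 5, i ≠ j → i ≠ l → j ≠ l → ∃ c ∈ alternatingGroup X,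
      IsCycle K ![k i, k j, k l] c ∧ ∀ x, x ∉ D → c x = x := by
    intro i j l hij hil hjl
    obtain ⟨c, hc, hcyc⟩ := exists_isCycle (K := K) (f := ![k i, k j, k l])
      (fun s => by fin_cases s; exacts [hk i, hk j, hk l])
      (fun s t hst => by
        fin_cases s <;> fin_cases t
        exacts [(hst rfl).elim, hkd i j hij, hkd i l hil, hkd j i hij.symm, (hst rfl).elim,
          hkd j l hjl, hkd l i hil.symm, hkd l j hjl.symm, (hst rfl).elim])
    refine ⟨c, hc, hcyc, fun x hx => hcyc.apply_of_notMem x fun s hs => hx ?_⟩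
    fin_cases s
    exacts [hkD i hs, hkD j hs, hkD l hs]
  obtain ⟨c₁, hc₁, hcyc₁, hfix₁⟩ := cyc 0 1 2 (by decide) (by decide) (by decide)
  obtain ⟨c₂, hc₂, hcyc₂, hfix₂⟩ := cyc 2 3 4 (by decide) (by decide) (by decide)
  have hN := hcomm c₁ hc₁ c₂ hc₂ hfix₁ hfix₂
  have hcyc := hcyc₁.commutator (fun i j hij => hkd i j hij) hcyc₂
  let k' : Fin 3 → X → X := ![k 0, k 3, k 2]
  have hu' : (⋃ s, k' s '' K) ≠ Set.univ := fun hu' => by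
    obtain ⟨y, hy⟩ := hCne 5
    obtain ⟨s, hs⟩ := Set.mem_iUnion.1 (hu' ▸ Set.mem_univ y)
    have hC5 : ∀ i : Fin 5, y ∉ k i '' K := fun i hi =>
      (hCd (show (i : ℕ) ≠ 5 by omega)).le_bot ⟨hkC i hi, hy⟩
    fin_cases s
    exacts [hC5 0 hs, hC5 3 hs, hC5 2 hs]
  obtain ⟨a, ha, hak⟩ := exists_intertwining hinf hmin (K := fun _ : Fin 3 => K) (f := k')
    (f' := f) (fun s => by fin_cases s; exacts [hk 0, hk 3, hk 2]) hf
    (fun s t hst => by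
        fin_cases s <;> fin_cases t
        exacts [(hst rfl).elim, hkd 0 3 (by decide), hkd 0 2 (by decide), hkd 3 0 (by decide),
          (hst rfl).elim, hkd 3 2 (by decide), hkd 2 0 (by decide), hkd 2 3 (by decide),
          (hst rfl).elim]) hd hu' hu
  have := (hcyc.conj a).congr (f' := f) fun i x hx => hak i x hx
  rw [hc.unique this]
  exact hconj _ hN a ha

/-- The element is a three-cycle on copies of `C 3` inside `C 0`, `C 1`, `C 2`; its support misses
`C 3`, hence is proper. -/
theorem exists_isShiftable [Nonempty X] (hinf : IsPurelyInfinite X) (hmin : IsMinimal X) :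
    ∃ (h : alternatingGroup X) (V : Set X), GroupCharacter.IsShiftable h V := by
  obtain ⟨C, hC, hCne, -, hCd⟩ := hinf.exists_seq isClopen_univ Set.univ_nonempty
  have hex : ∀ i : Fin 3, ∃ f : X → X, IsEmb f (C 3) ∧ f '' C 3 ⊆ C i := fun i =>
    exists_isEmb_into hinf hmin (hC 3) (hC i) (hCne i)
  choose f hf hfC using hex
  have hd : Pairwise fun i j => Disjoint (f i '' C 3) (f j '' C 3) := fun i j hij =>
    (hCd fun h => hij (Fin.ext h)).mono (hfC i) (hfC j)
  obtain ⟨c, hcA, hc⟩ := exists_isCycle hf hd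
  obtain ⟨x₀, hx₀⟩ := hCne 3
  have hVcl : IsClopen (⋃ i, f i '' C 3) :=
    isClopen_iUnion_of_finite fun i => (hf i).isClopen_image
  have hVu : (⋃ i, f i '' C 3) ≠ Set.univ := fun hu => by
    obtain ⟨i, hi⟩ := Set.mem_iUnion.1 (hu ▸ Set.mem_univ x₀)
    exact (hCd (show (i : ℕ) ≠ 3 by omega)).le_bot ⟨hfC i hi, hx₀⟩
  have hsmul : ∀ (a : alternatingGroup X) (S : Set X), a • S = (a : X ≃ₜ X) '' S :=
    fun _ _ => rfl
  have hne1 : c ≠ 1 := fun h1 => by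
    have h2 := hc.apply 0 x₀ hx₀
    rw [h1] at h2
    exact (hd (show (0 : Fin 3) ≠ 1 by decide)).le_bot ⟨⟨x₀, hx₀, rfl⟩, ⟨x₀, hx₀, h2.symm⟩⟩
  refine ⟨⟨c, hcA⟩, ⋃ i, f i '' C 3, ?_, hVu, ?_, ?_, ?_, ?_, ?_, ?_, ?_, ?_⟩
  · exact ⟨f 0 x₀, Set.mem_iUnion.2 ⟨0, x₀, hx₀, rfl⟩⟩
  · intro a
    rw [hsmul]
    exact (isEmb_of_mem_alternatingGroup a.2 hVcl).isClopen_image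
  · exact Subtype.ext hc.pow_three
  · intro z hz
    refine Subtype.ext (mul_comm_of_disjoint (S := (⋃ i, f i '' C 3)ᶜ) disjoint_compl_left
      (fun x hx => hz x (not_not.1 hx)) fun x hx => hc.apply_of_notMem x fun i hi =>
        hx (Set.mem_iUnion.2 ⟨i, hi⟩))
  -- An element exchanging the first two copies reverses the direction of the cycle.
  · let f' : Fin 3 → X → X := ![f 1, f 0, f 2]
    let σ : Equiv.Perm (Fin 3) := Equiv.swap 0 1
    have hσ : ∀ i, f' i = f (σ i) := fun i => by
      fin_cases i <;> rfl
    have hU : (⋃ i, f' i '' C 3) = ⋃ i, f i '' C 3 := by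
      simp only [hσ]
      exact σ.surjective.iUnion_comp fun i => f i '' C 3
    obtain ⟨t, ht, htf⟩ := exists_intertwining hinf hmin (K := fun _ : Fin 3 => C 3) (f := f)
      (f' := f') hf (fun i => by rw [hσ]; exact hf _) hd
      (fun i j hij => by simp only [hσ]; exact hd fun h => hij (σ.injective h)) hVu (hU ▸ hVu)
    refine ⟨⟨t, ht⟩, ?_, Subtype.ext ?_⟩
    · rw [hsmul, Set.image_iUnion]
      refine Eq.trans (Set.iUnion_congr fun i => ?_) hU
      rw [Set.image_image]
      exact Set.image_congr (htf i)
    · exact ((hc.conj t).congr (f' := f') fun i x hx => htf i x hx).unique hc.inv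
  · intro n a a' hd hd' hu hu'
    obtain ⟨b, hb, hba⟩ := exists_intertwining hinf hmin (K := fun _ : Fin n => ⋃ i, f i '' C 3)
      (f := fun i => (a i : X ≃ₜ X)) (f' := fun i => (a' i : X ≃ₜ X))
      (fun i => isEmb_of_mem_alternatingGroup (a i).2 hVcl)
      (fun i => isEmb_of_mem_alternatingGroup (a' i).2 hVcl) hd hd' hu hu'
    exact ⟨⟨b, hb⟩, hba⟩
  · intro D hD hDne
    obtain ⟨E, hE, hEne, hED, hEd⟩ := hinf.exists_seq hD hDne
    have hex : ∀ n, ∃ a : alternatingGroup X, a • (⋃ i, f i '' C 3) ⊆ E n := fun n => by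
      obtain ⟨φ, hφ, hφE⟩ := exists_isEmb_into hinf hmin hVcl (hE n) (hEne n)
      -- A point of the next set shows that the image is proper, as the extension requires.
      obtain ⟨y, hy⟩ := hEne (n + 1)
      obtain ⟨a, ha, haφ⟩ := exists_extension hinf hmin hφ hVu fun hu =>
        (hEd (Nat.succ_ne_self n)).le_bot ⟨hy, hφE (hu ▸ Set.mem_univ y)⟩
      refine ⟨⟨a, ha⟩, ?_⟩
      rw [hsmul, Set.image_congr haφ]
      exact hφE
    choose a ha using hex
    exact ⟨a, fun k => (ha k).trans (hED k), fun i j hij => (hEd hij).mono (ha i) (ha j)⟩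
  · let N := (Subgroup.normalClosure {(⟨c, hcA⟩ : alternatingGroup X)}).map
      (alternatingGroup X).subtype
    have hcN : c ∈ N := ⟨⟨c, hcA⟩, Subgroup.subset_normalClosure rfl, rfl⟩
    have hle : alternatingGroup X ≤ N := by
      refine alternatingGroup_le_of_normal hinf hmin ?_ hcN hne1
      rintro _ ⟨n, hn, rfl⟩ a ha
      exact ⟨⟨a, ha⟩ * n * ⟨a, ha⟩⁻¹, Subgroup.normalClosure_normal.conj_mem n hn ⟨a, ha⟩, rfl⟩
    refine eq_top_iff.2 fun g _ => ?_
    obtain ⟨g', hg', hgg⟩ := hle g.2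
    rwa [← Subtype.ext hgg]
  · intro g hg
    exact hinf.exists_displaced fun h => hg (Subtype.ext h)

end Simplicity

end TopGroupoid

theorem corollaryD {X : Type u} [TopologicalSpace X] [CategoryTheory.Groupoid.{v} X]
    [TopologicalSpace (CategoryTheory.Arrow X)] [T2Space (CategoryTheory.Arrow X)]
    [TopGroupoid.EtaleGroupoid X] [TopGroupoid.CantorSpace X]
    (heffective : TopGroupoid.IsEffective X)
    (hinfinite : TopGroupoid.IsPurelyInfinite X) (hminimal : TopGroupoid.IsMinimal X) :
    GroupCharacter.HasNoProperCharacters (TopGroupoid.alternatingGroup X) := by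
  obtain ⟨e⟩ := TopGroupoid.CantorSpace.nonempty_homeomorph (X := X)
  have : T2Space X := e.isEmbedding.t2Space
  have : TotallyDisconnectedSpace X :=
    ⟨e.isEmbedding.isTotallyDisconnected (isTotallyDisconnected_of_totallyDisconnectedSpace _)⟩
  have : Nonempty X := ⟨e.symm fun _ => false⟩
  obtain ⟨h, V, hs⟩ := TopGroupoid.exists_isShiftable hinfinite hminimal
  exact hs.hasNoProperCharacters
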